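/- Let $m\ge 0$ and let $C=(C_{i,j})$ be a symmetric $m\times m$ matrix of non-negative integers (a symmetric quiver with $m$ vertices and $C_{i,j}$ arrows from $i$ to $j$). Put $(q^2;q^2)_d=\prod_{k=1}^{d}(1-q^{2k})$ and let $$P_C(x_1,\dots,x_m)=\sum_{d_1,\dots,d_m\ge 0}\frac{(-q)^{\sum_{i,j}C_{i,j}d_id_j}}{(q^2;q^2)_{d_1}\cdots(q^2;q^2)_{d_m}}\,x_1^{d_1}\cdots x_m^{d_m}$$ be its motivic generating series. A set of pairs $(i_u,j_u)\in\{1,\dots,m\}^2$ is called admissible if its second entries $j_u$ are pairwise distinct and it contains no cycle, i.e. no distinct pairs $(i_1,j_1),\dots,(i_r,j_r)$, $r\ge1$, with $j_s=i_{s+1}$ for $s<r$ and $j_r=i_1$. Define the polynomials $$A(l_1,\dots,l_m)=1+\sum_{k=1}^{m-1}\ \sum_{\substack{\Sigma\text{ admissible}\\|\Sigma|=k}}\ \prod_{(i,j)\in\Sigma}C_{i,j}l_i,\qquad A_{\max}(l_1,\dots,l_m)=\sum_{\substack{\Sigma\text{ admissible}\\|\Sigma|=m-1}}\ \prod_{(i,j)\in\Sigma}C_{i,j}l_i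 .$$ (For $m=0$ the number $m-1$ is read as $0$.) Then: 1. The limit $y(x_1,\dots,x_m)=\lim_{q\to1}P_C(q^2x_1,\dots,q^2x_m)/P_C(x_1,\dots,x_m)$ exists coefficientwise, is a formal power series with constant term $1$, and $$\log y(x_1,\dots,x_m)=\sum_{l\ne 0}c_l\,x^l,\qquad c_l=(-1)^{\sum_i(C_{i,i}+1)l_i}\,A_{\max}(l_1,\dots,l_m)\prod_{j=1}^m\frac{1}{\sum_iC_{i,j}l_i}\binom{\sum_iC_{i,j}l_i}{l_j},$$ the sum being over $l=(l_1,\dots,l_m)\in\mathbb Z_{\ge0}^m\setminus\{0\}$. If some $\sum_iC_{i,j}l_i$ is $0$, the expression for $c_l$ is understood by continuity in the entries of the matrix: $c_l$ is the limit, which exists, of the sign $(-1)^{\sum_i(C_{i,i}+1)l_i}$ times the expression $A_{\max}(l)\prod_j\frac{1}{\sum_iM_{i,j}l_i}\binom{\sum_iM_{i,j}l_i}{l_j}$ formed with a real matrix $M$ in place of $C$, as $M\to C$ through matrices with $\sum_iM_{i,j}l_i\neq0$ for all $j$. 2. The largest size of an admissible set is $m-1$. The polynomial $A$ has degree at most $m-1$,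 and $A_{\max}$ is its homogeneous part of degree $m-1$. 3. There are integers $\Omega_d$ ($d\in\mathbb Z_{\ge0}^m\setminus\{0\}$), the numerical Donaldson–Thomas invariants, with $y=\prod_{d\ne0}(1-x^d)^{\Omega_d}$, and for any such family $$\Omega_d=-\sum_{n\mid\gcd(d_1,\dots,d_m)}\frac{\mu(n)}{n}\,c_{d/n}\qquad\text{for all }d\neq0,$$ where $\mu$ is the Möbius function. -/

import Mathlib

open Filter Topology Finset
open scoped MvPowerSeries.WithPiTopology

namespace SymmetricQuiver

noncomputable section

/-- The `q`-Pochhammer symbol `(a; q)_n = ∏_{k < n} (1 - a q ^ k)`. -/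
def qPochhammer (a q : ℝ) (n : ℕ) : ℝ :=
  ∏ k ∈ range n, (1 - a * q ^ k)

/-- The motivic generating series
`P_C(x) = ∑_d (-q) ^ (∑_{i,j} C_{ij} d_i d_j) / ∏_i (q²; q²)_{d_i} * x ^ d`
of the quiver with `C i j` arrows from `i` to `j`, at a real value of `q`. -/
def motivicSeries {m : ℕ} (C : Matrix (Fin m) (Fin m) ℕ) (q : ℝ) : MvPowerSeries (Fin m) ℝ :=
  fun d => (-q) ^ (∑ i, ∑ j, C i j * d i * d j) / ∏ i, qPochhammer (q ^ 2) (q ^ 2) (d i)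

/-- The quotient `P_C(q² x_1, …, q² x_m) / P_C(x_1, …, x_m)`. The divisor has constant term `1`,
so it is invertible as a power series. -/
def quotientSeries {m : ℕ} (C : Matrix (Fin m) (Fin m) ℕ) (q : ℝ) : MvPowerSeries (Fin m) ℝ :=
  MvPowerSeries.rescale (fun _ => q ^ 2) (motivicSeries C q) * (motivicSeries C q)⁻¹

/-- `y` is the coefficientwise limit of the quotient series as `q → 1`, `q ≠ 1`. -/
def IsClassicalLimit {m : ℕ} (C : Matrix (Fin m) (Fin m) ℕ) (y : MvPowerSeries (Fin m) ℝ) : Prop :=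
  ∀ l : Fin m →₀ ℕ,
    Tendsto (fun q : ℝ => MvPowerSeries.coeff l (quotientSeries C q)) (𝓝[≠] 1)
      (𝓝 (MvPowerSeries.coeff l y))

/-- The formal logarithm `log (1 + (y - 1)) = ∑_{k ≥ 1} (-1) ^ (k + 1) (y - 1) ^ k / k` of a series
`y` with constant term `1`. -/
def logSeries {m : ℕ} (y : MvPowerSeries (Fin m) ℝ) : MvPowerSeries (Fin m) ℝ :=
  (PowerSeries.log ℝ).subst (y - 1)

/-- A set of pairs is admissible if no two of its pairs have the same second entry and it has no
cycle: there is no sequence of `n + 1 ≥ 1` distinct pairs in it such that the second entry of each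
is the first entry of the next one, cyclically (addition in `Fin (n + 1)` is cyclic). -/
def IsAdmissible {m : ℕ} (S : Finset (Fin m × Fin m)) : Prop :=
  (∀ p ∈ S, ∀ p' ∈ S, p.2 = p'.2 → p = p') ∧
  ∀ (n : ℕ) (f : Fin (n + 1) → Fin m × Fin m), Function.Injective f → (∀ t, f t ∈ S) →
    ¬ ∀ t, (f t).2 = (f (t + 1)).1

open Classical in
/-- The admissible sets of `k` pairs. -/
def admissibleSets (m k : ℕ) : Finset (Finset (Fin m × Fin m)) :=
  {S | IsAdmissible S ∧ S.card = k}

/-- The polynomial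
`A(l_1, …, l_m) = 1 + ∑_{k=1}^{m-1} ∑_{admissible S, |S| = k} ∏_{(i,j) ∈ S} M_{ij} l_i`. -/
def polyA {m : ℕ} (M : Matrix (Fin m) (Fin m) ℝ) : MvPolynomial (Fin m) ℝ :=
  1 + ∑ k ∈ Finset.Icc 1 (m - 1), ∑ S ∈ admissibleSets m k,
    ∏ p ∈ S, MvPolynomial.C (M p.1 p.2) * MvPolynomial.X p.1

/-- The polynomial
`A_max(l_1, …, l_m) = ∑_{admissible S, |S| = m - 1} ∏_{(i,j) ∈ S} M_{ij} l_i`. -/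
def polyAmax {m : ℕ} (M : Matrix (Fin m) (Fin m) ℝ) : MvPolynomial (Fin m) ℝ :=
  ∑ S ∈ admissibleSets m (m - 1), ∏ p ∈ S, MvPolynomial.C (M p.1 p.2) * MvPolynomial.X p.1

/-- `A_max(l_1, …, l_m)` as a number. -/
def Amax {m : ℕ} (M : Matrix (Fin m) (Fin m) ℝ) (l : Fin m →₀ ℕ) : ℝ :=
  MvPolynomial.eval (fun i => (l i : ℝ)) (polyAmax M)

/-- The linear form `∑_i M_{ij} l_i`. -/
def linForm {m : ℕ} (M : Matrix (Fin m) (Fin m) ℝ) (l : Fin m →₀ ℕ) (j : Fin m) : ℝ :=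
  ∑ i, M i j * (l i : ℝ)

/-- `A_max(l) ∏_j (1 / ∑_i M_{ij} l_i) * binom (∑_i M_{ij} l_i, l_j)` for a matrix `M` of real
numbers (`Ring.choose` is the binomial coefficient with arbitrary upper entry). It is used only
where all the linear forms are nonzero. -/
def unsignedTerm {m : ℕ} (M : Matrix (Fin m) (Fin m) ℝ) (l : Fin m →₀ ℕ) : ℝ :=
  Amax M l * ∏ j, (1 / linForm M l j * Ring.choose (linForm M l j) (l j))

/-- The filter of neighbourhoods of `C` within the set of real matrices at which no denominator of
`unsignedTerm` vanishes. -/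
def regularNhds {m : ℕ} (C : Matrix (Fin m) (Fin m) ℕ) (l : Fin m →₀ ℕ) :
    Filter (Matrix (Fin m) (Fin m) ℝ) :=
  𝓝[{M | ∀ j, linForm M l j ≠ 0}] (C.map (fun n : ℕ => (n : ℝ)))

/-- `∑_i (C_{ii} + 1) l_i`, the exponent of the sign. -/
def signExponent {m : ℕ} (C : Matrix (Fin m) (Fin m) ℕ) (l : Fin m →₀ ℕ) : ℕ :=
  ∑ i, (C i i + 1) * l i

/-- The explicit coefficient of `x ^ l`, where a vanishing denominator is resolved by
continuity in the entries of the matrix. -/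
def logCoeff {m : ℕ} (C : Matrix (Fin m) (Fin m) ℕ) (l : Fin m →₀ ℕ) : ℝ :=
  (-1) ^ signExponent C l * limUnder (regularNhds C l) (fun M => unsignedTerm M l)

/-- The power series `(1 - x ^ d) ^ n` for a nonzero exponent vector `d` and an integer `n`. -/
def eulerFactor {m : ℕ} (d : Fin m →₀ ℕ) (n : ℤ) : MvPowerSeries (Fin m) ℝ :=
  (1 - MvPowerSeries.monomial d 1) ^ n.toNat * ((1 - MvPowerSeries.monomial d 1)⁻¹) ^ (-n).toNat

/-- `Ω` is the family of numerical Donaldson-Thomas invariants read off from `y`: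
`y = ∏_{d ≠ 0} (1 - x ^ d) ^ Ω_d`. -/
def IsDTFamily {m : ℕ} (y : MvPowerSeries (Fin m) ℝ) (Ω : {d : Fin m →₀ ℕ // d ≠ 0} → ℤ) : Prop :=
  HasProd (fun d : {d : Fin m →₀ ℕ // d ≠ 0} => eulerFactor d.1 (Ω d)) y

/-- The entrywise (truncated) quotient `l / n`; it is used only when `n` divides every entry. -/
def divVec {m : ℕ} (l : Fin m →₀ ℕ) (n : ℕ) : Fin m →₀ ℕ :=
  l.mapRange (fun a => a / n) (Nat.zero_div n)

end

end SymmetricQuiver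

/-!
Write `F_c = P_C(q ^ (2c) x) / P_C(x)` for a vector `c` of natural numbers. The recurrence of the
`q`-Pochhammer symbol gives `F_{c + e_j} = F_c - (-q) ^ C_jj * q ^ (2 c_j) * x_j * F_{c + C_j}`,
with `F_0 = 1`, and by induction on the degree this determines every coefficient of every `F_c`,
also in the limit `q → 1`. The solution of the limiting recurrence is explicit: up to a sign, the
coefficient of `x ^ l` is the determinant of a matrix of binomial coefficients in `c + C l`, as in
multivariate Lagrange inversion. Hence the limits exist and are integral, and `F_{c + c'} =
F_c * F_c'` at `q = 1` since rescaling becomes trivial there.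

So the coefficient of `x ^ l` in `y ^ n` is a polynomial in `n`, and its linear coefficient is that
of `log y`. When no linear form vanishes, binomials factor out of the determinant and leave the
characteristic determinant of a weighted Laplacian, which the matrix-tree theorem expands over
admissible sets; the linear term in `n` is the part over the largest ones, `A_max`. The determinant
is polynomial in the entries of the matrix, which settles the remaining `l` by continuity.

The Euler product is found by dividing off the factors `(1 - x ^ d) ^ Ω_d` degree by degree, over
the integers; taking logarithms turns it into a divisor sum, which Möbius inversion solves.
-/

namespace SymmetricQuiver

section LagrangeMatrix

variable {R S : Type*} [CommRing R] [BinomialRing R] [CommRing S] [BinomialRing S]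
  {ι : Type*} [DecidableEq ι]

/-- The binomial coefficient `binom (s - 1, n - 1)`, with value `0` at `n = 0`. It plays the role
of `n / s * binom (s, n)` and makes sense also at `s = 0`. -/
def choosePred (s : R) : ℕ → R
  | 0 => 0
  | n + 1 => Ring.choose (s - 1) n

lemma choose_add_one (s : R) (n : ℕ) :
    Ring.choose (s + 1) (n + 1) = Ring.choose s (n + 1) + Ring.choose s n := by
  rw [Ring.choose_succ_succ, add_comm]

lemma choosePred_add_one (s : R) (n : ℕ) :
    choosePred (s + 1) (n + 1) = choosePred s (n + 1) + choosePred s n := by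
  cases n with
  | zero => simp [choosePred]
  | succ n => simpa [choosePred] using choose_add_one (s - 1) n

lemma natCast_mul_choose (s : R) (n : ℕ) :
    (n : R) * Ring.choose s n = s * choosePred s n := by
  cases n with
  | zero => simp [choosePred]
  | succ n =>
    have := BinomialRing.toIsAddTorsionFree (R := R)
    apply nsmul_right_injective (Nat.factorial_ne_zero n)
    have descPochhammer_succ : (descPochhammer ℤ (n + 1)).smeval s =
        s * (descPochhammer ℤ n).smeval (s - 1) := by
      rw [descPochhammer_succ_left, Polynomial.smeval_X_mul, Polynomial.smeval_comp]
      simp [Polynomial.smeval_sub, Polynomial.smeval_X, Polynomial.smeval_one]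
    rw [Ring.descPochhammer_eq_factorial_smul_choose, Ring.descPochhammer_eq_factorial_smul_choose,
      Nat.factorial_succ] at descPochhammer_succ
    simp only [choosePred, nsmul_eq_mul] at descPochhammer_succ ⊢
    push_cast at descPochhammer_succ ⊢
    linear_combination descPochhammer_succ

lemma map_choosePred (f : R →+* S) (s : R) (n : ℕ) :
    f (choosePred s n) = choosePred (f s) n := by
  cases n with
  | zero => simp [choosePred]
  | succ n => simp [choosePred, Ring.map_choose]

/-- The matrix with entries `δ_{ij} binom (s_i, l_i) - binom (s_i - 1, l_i - 1) M_{ij}`. By Lagrange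
inversion, for `s_i = c_i + ∑_k M_{ik} l_k` its determinant is the coefficient of `t ^ l` in
`∏_i y_i ^ c_i`, where `y_j = 1 + t_j ∏_i y_i ^ M_{ij}`. -/
def lagrangeMatrix (M : Matrix ι ι R) (s : ι → R) (l : ι → ℕ) : Matrix ι ι R :=
  fun i j => (if i = j then Ring.choose (s i) (l i) else 0) - choosePred (s i) (l i) * M i j

lemma map_lagrangeMatrix (f : R →+* S) (M : Matrix ι ι R) (s : ι → R) (l : ι → ℕ) :
    (lagrangeMatrix M s l).map f = lagrangeMatrix (M.map f) (f ∘ s) l := by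
  ext i j
  simp only [lagrangeMatrix, Matrix.map_apply, map_sub, map_mul, map_choosePred,
    Function.comp_apply]
  split_ifs <;> simp only [Ring.map_choose, map_zero]

lemma lagrangeMatrix_zero (M : Matrix ι ι R) (s : ι → R) : lagrangeMatrix M s 0 = 1 := by
  ext i k
  simp [lagrangeMatrix, choosePred, Matrix.one_apply]

lemma lagrangeMatrix_add_single_of_eq_zero (M : Matrix ι ι R) (s : ι → R) {l : ι → ℕ} {j : ι}
    (hl : l j = 0) : lagrangeMatrix M (s + Pi.single j 1) l = lagrangeMatrix M s l := by
  ext i k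
  obtain rfl | hij := eq_or_ne i j
  · simp [lagrangeMatrix, hl, choosePred]
  · simp [lagrangeMatrix, Pi.single_eq_of_ne hij]

variable [Fintype ι]

lemma map_det_lagrangeMatrix (f : R →+* S) (M : Matrix ι ι R) (s : ι → R) (l : ι → ℕ) :
    f (lagrangeMatrix M s l).det = (lagrangeMatrix (M.map f) (f ∘ s) l).det := by
  rw [RingHom.map_det, RingHom.mapMatrix_apply, map_lagrangeMatrix]

/-- Pascal's rule in the `j`-th row. -/
lemma det_lagrangeMatrix_add_single (M : Matrix ι ι R) (s : ι → R) (l : ι → ℕ) (j : ι) :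
    (lagrangeMatrix M (s + Pi.single j 1) (l + Pi.single j 1)).det =
      (lagrangeMatrix M s (l + Pi.single j 1)).det + (lagrangeMatrix M s l).det := by
  have add_row : lagrangeMatrix M (s + Pi.single j 1) (l + Pi.single j 1) =
      (lagrangeMatrix M s l).updateRow j
        (lagrangeMatrix M s (l + Pi.single j 1) j + lagrangeMatrix M s l j) := by
    ext i k
    obtain rfl | hij := eq_or_ne i j
    · simp only [lagrangeMatrix, Matrix.updateRow_self, Pi.add_apply, Pi.single_eq_same,
        choose_add_one, choosePred_add_one]
      split_ifs <;> ring
    · simp [Matrix.updateRow_ne hij, lagrangeMatrix, Pi.single_eq_of_ne hij]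
  have upper_row : lagrangeMatrix M s (l + Pi.single j 1) =
      (lagrangeMatrix M s l).updateRow j (lagrangeMatrix M s (l + Pi.single j 1) j) := by
    ext i k
    obtain rfl | hij := eq_or_ne i j
    · simp
    · simp [Matrix.updateRow_ne hij, lagrangeMatrix, Pi.single_eq_of_ne hij]
  rw [add_row, Matrix.det_updateRow_add, Matrix.updateRow_eq_self, ← upper_row]

/-- Under this hypothesis the vector `l` lies in the kernel. -/
lemma det_lagrangeMatrix_eq_zero [IsDomain R] [CharZero R] {M : Matrix ι ι R} {s : ι → R}
    {l : ι → ℕ} (hl : l ≠ 0) (hs : M.mulVec (fun j => (l j : R)) = s) :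
    (lagrangeMatrix M s l).det = 0 := by
  refine Matrix.exists_mulVec_eq_zero_iff.1 ⟨fun i => (l i : R), ?_, ?_⟩
  · exact fun h => hl (funext fun i => by simpa using congrFun h i)
  · ext i
    have row_sum : ∑ j, choosePred (s i) (l i) * M i j * (l j : R) =
        choosePred (s i) (l i) * s i := by
      simp only [← hs, Matrix.mulVec, dotProduct, Finset.mul_sum, mul_assoc]
    simp only [Matrix.mulVec, dotProduct, lagrangeMatrix, sub_mul, Finset.sum_sub_distrib, row_sum,
      ite_mul, zero_mul, Finset.sum_ite_eq, Finset.mem_univ, if_true, Pi.zero_apply]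
    linear_combination natCast_mul_choose (s i) (l i)

lemma prod_mul_det_lagrangeMatrix (M : Matrix ι ι R) (s : ι → R) (l : ι → ℕ) :
    (∏ i, s i) * (lagrangeMatrix M s l).det =
      (∏ i, Ring.choose (s i) (l i)) *
        (Matrix.diagonal s - Matrix.of fun i j => (l i : R) * M i j).det := by
  rw [← Matrix.det_mul_column, ← Matrix.det_mul_column]
  congr 1
  ext i j
  simp only [lagrangeMatrix, Matrix.of_apply, Matrix.sub_apply, Matrix.diagonal_apply]
  split_ifs <;> linear_combination M i j * natCast_mul_choose (s i) (l i)

end LagrangeMatrix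

section ShiftRecurrence

variable {ι : Type*} [DecidableEq ι] {R S : Type*} [CommRing R] [CommRing S]

/-- The recurrence `F_{c + e_j} = F_c - a_{c, j} x_j F_{c + C_j}` for a family of power series
indexed by exponent vectors `c`, where `C_j` is the `j`-th row of `C`. -/
def ShiftRecurrence (C : Matrix ι ι ℕ) (a : (ι → ℕ) → ι → R) (F : (ι → ℕ) → MvPowerSeries ι R) :
    Prop :=
  ∀ c j, F (c + Pi.single j 1) =
    F c - MvPowerSeries.C (a c j) * (MvPowerSeries.X j * F (c + C j))

namespace ShiftRecurrence

variable {C : Matrix ι ι ℕ} {a : (ι → ℕ) → ι → R} {F : (ι → ℕ) → MvPowerSeries ι R}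

lemma coeff_add_single (hF : ShiftRecurrence C a F) (c : ι → ℕ) (j : ι) (l : ι →₀ ℕ) :
    MvPowerSeries.coeff l (F (c + Pi.single j 1)) = MvPowerSeries.coeff l (F c) -
      if Finsupp.single j 1 ≤ l then
        a c j * MvPowerSeries.coeff (l - Finsupp.single j 1) (F (c + C j)) else 0 := by
  rw [hF, map_sub, MvPowerSeries.coeff_C_mul, MvPowerSeries.X, MvPowerSeries.coeff_monomial_mul]
  split_ifs <;> simp only [one_mul, mul_zero]

lemma mul_right (hF : ShiftRecurrence C a F) (g : MvPowerSeries ι R) :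
    ShiftRecurrence C a fun c => F c * g := by
  intro c j
  simp only [hF c j]
  ring

lemma comp_add_left (hF : ShiftRecurrence C a F) (b : ι → ℕ) :
    ShiftRecurrence C (fun c => a (b + c)) fun c => F (b + c) := by
  intro c j
  simp only [← add_assoc, hF (b + c) j]

lemma map (hF : ShiftRecurrence C a F) (f : R →+* S) :
    ShiftRecurrence C (fun c j => f (a c j)) fun c => MvPowerSeries.map f (F c) := by
  intro c j
  simp only [hF c j, map_sub, map_mul, MvPowerSeries.map_C, MvPowerSeries.map_X]

end ShiftRecurrence

lemma pi_induction_add_single [Finite ι] {p : (ι → ℕ) → Prop} (zero : p 0)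
    (add_single : ∀ c j, p c → p (c + Pi.single j 1)) (c : ι → ℕ) : p c := by
  suffices h : ∀ f : ι →₀ ℕ, p f by
    simpa using h (Finsupp.equivFunOnFinite.symm c)
  intro f
  induction f using Finsupp.induction₂ with
  | zero => exact zero
  | add_single j n f _ _ ih =>
    clear * - ih add_single
    induction n with
    | zero => simpa using ih
    | succ n ihn =>
      simpa only [Finsupp.single_add, ← add_assoc, Finsupp.coe_add,
        Finsupp.single_eq_pi_single] using add_single _ j ihn

namespace ShiftRecurrence

variable [Finite ι] {C : Matrix ι ι ℕ}

/-- The recurrence determines the coefficients by induction on the degree, and within one degree by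
induction on the index of the family. -/
theorem tendsto [TopologicalSpace R] [IsTopologicalRing R] {α : Type*} {L : Filter α}
    {a : α → (ι → ℕ) → ι → R} {b : (ι → ℕ) → ι → R} {F : α → (ι → ℕ) → MvPowerSeries ι R}
    {G : (ι → ℕ) → MvPowerSeries ι R} (hF : ∀ᶠ t in L, ShiftRecurrence C (a t) (F t))
    (hG : ShiftRecurrence C b G) (hab : ∀ c j, Tendsto (fun t => a t c j) L (𝓝 (b c j)))
    (h0 : Tendsto (fun t => F t 0) L (𝓝 (G 0))) (c : ι → ℕ) :
    Tendsto (fun t => F t c) L (𝓝 (G c)) := by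
  simp only [MvPowerSeries.WithPiTopology.tendsto_iff_coeff_tendsto] at h0 ⊢
  intro l
  induction hn : l.degree using Nat.strong_induction_on generalizing l c with
  | _ n ih_degree =>
    induction c using pi_induction_add_single with
    | zero => exact h0 l
    | add_single c j ih =>
      rw [hG.coeff_add_single]
      refine Tendsto.congr'
        (hF.mono fun t ht => (ht.coeff_add_single c j l).symm) (ih.sub ?_)
      split_ifs with hl
      · have degree_lt : (l - Finsupp.single j 1).degree < n := by
          rw [← hn]
          conv_rhs => rw [← tsub_add_cancel_of_le hl, map_add, Finsupp.degree_single]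
          exact Nat.lt_succ_self _
        exact (hab c j).mul (ih_degree _ degree_lt _ _ rfl)
      · exact tendsto_const_nhds

theorem unique {a : (ι → ℕ) → ι → R} {F G : (ι → ℕ) → MvPowerSeries ι R}
    (hF : ShiftRecurrence C a F) (hG : ShiftRecurrence C a G) (h0 : F 0 = G 0) : F = G := by
  let _ : TopologicalSpace R := ⊥
  have : DiscreteTopology R := ⟨rfl⟩
  funext c
  have tendsto_const : Tendsto (fun _ : Unit => F c) ⊤ (𝓝 (G c)) :=
    ShiftRecurrence.tendsto (F := fun _ => F) (a := fun _ => a) (.of_forall fun _ => hF) hG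
      (fun _ _ => tendsto_const_nhds) (h0 ▸ tendsto_const_nhds) c
  exact tendsto_nhds_unique tendsto_const_nhds tendsto_const

end ShiftRecurrence

end ShiftRecurrence

section LagrangeSeries

variable {m : ℕ}

/-- The power series with the signed Lagrange inversion coefficients attached to `C` and `c`. As
`q → 1` it turns out to be the limit of `P_C(q ^ (2 c_1) x_1, …, q ^ (2 c_m) x_m) / P_C(x)`. -/
noncomputable def lagrangeSeries (C : Matrix (Fin m) (Fin m) ℕ) (c : Fin m → ℕ) :
    MvPowerSeries (Fin m) ℤ :=
  fun l => (-1) ^ signExponent C l *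
    (lagrangeMatrix (C.map Nat.cast) (fun i => (c i + ∑ k, C k i * l k : ℤ)) l).det

lemma coeff_lagrangeSeries (C : Matrix (Fin m) (Fin m) ℕ) (c : Fin m → ℕ) (l : Fin m →₀ ℕ) :
    MvPowerSeries.coeff l (lagrangeSeries C c) = (-1) ^ signExponent C l *
      (lagrangeMatrix (C.map Nat.cast) (fun i => (c i + ∑ k, C k i * l k : ℤ)) l).det :=
  rfl

lemma constantCoeff_lagrangeSeries (C : Matrix (Fin m) (Fin m) ℕ) (c : Fin m → ℕ) :
    MvPowerSeries.constantCoeff (lagrangeSeries C c) = 1 := by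
  rw [← MvPowerSeries.coeff_zero_eq_constantCoeff_apply, coeff_lagrangeSeries, Finsupp.coe_zero,
    lagrangeMatrix_zero]
  simp [signExponent]

lemma lagrangeSeries_zero (C : Matrix (Fin m) (Fin m) ℕ) (hC : C.IsSymm) :
    lagrangeSeries C 0 = 1 := by
  ext l
  obtain rfl | hl := eq_or_ne l 0
  · simpa using constantCoeff_lagrangeSeries C 0
  · rw [coeff_lagrangeSeries, det_lagrangeMatrix_eq_zero (by simpa using hl), mul_zero,
      MvPowerSeries.coeff_one, if_neg hl]
    ext i
    simp [Matrix.mulVec, dotProduct, hC.apply]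

lemma signExponent_add_single (C : Matrix (Fin m) (Fin m) ℕ) (l : Fin m →₀ ℕ) (j : Fin m) :
    signExponent C (l + Finsupp.single j 1) = signExponent C l + (C j j + 1) := by
  simp [signExponent, mul_add, Finset.sum_add_distrib, Finsupp.single_apply]

lemma shiftRecurrence_lagrangeSeries (C : Matrix (Fin m) (Fin m) ℕ) :
    ShiftRecurrence C (fun _ j => (-1) ^ C j j) (lagrangeSeries C) := by
  intro c j
  ext l
  simp only [map_sub, MvPowerSeries.coeff_C_mul, MvPowerSeries.X,
    MvPowerSeries.coeff_monomial_mul, one_mul]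
  have shift_upper (l : Fin m →₀ ℕ) :
      (fun i => ((c + Pi.single j 1 : Fin m → ℕ) i + ∑ k, C k i * l k : ℤ)) =
        (fun i => (c i + ∑ k, C k i * l k : ℤ)) + Pi.single j 1 := by
    ext i
    obtain rfl | hij := eq_or_ne i j
    · simp [add_right_comm]
    · simp [Pi.single_eq_of_ne hij]
  split_ifs with hl
  · obtain ⟨l, rfl⟩ := exists_add_of_le hl
    have shift_lower : (fun i => ((c + C j) i + ∑ k, C k i * l k : ℤ)) =
        fun i => (c i + ∑ k, C k i * (l + Finsupp.single j 1 : Fin m →₀ ℕ) k : ℤ) := by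
      ext i
      simp [mul_add, Finset.sum_add_distrib, Finsupp.single_apply]
      ring
    rw [add_comm _ l, add_tsub_cancel_right]
    simp only [coeff_lagrangeSeries, shift_upper, shift_lower, signExponent_add_single]
    rw [Finsupp.coe_add, Finsupp.single_eq_pi_single, det_lagrangeMatrix_add_single, pow_add,
      pow_succ]
    ring
  · rw [Finsupp.single_le_iff, Nat.one_le_iff_ne_zero, not_not] at hl
    simp only [coeff_lagrangeSeries, shift_upper, lagrangeMatrix_add_single_of_eq_zero _ _ hl,
      mul_zero, sub_zero]

lemma lagrangeSeries_add (C : Matrix (Fin m) (Fin m) ℕ) (hC : C.IsSymm) (a b : Fin m → ℕ) :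
    lagrangeSeries C (a + b) = lagrangeSeries C b * lagrangeSeries C a := by
  have recurrence := shiftRecurrence_lagrangeSeries C
  refine congrFun ((recurrence.comp_add_left a).unique (recurrence.mul_right _) ?_) b
  rw [add_zero, lagrangeSeries_zero C hC, one_mul]

lemma lagrangeSeries_const (C : Matrix (Fin m) (Fin m) ℕ) (hC : C.IsSymm) (n : ℕ) :
    lagrangeSeries C (fun _ => n) = lagrangeSeries C (fun _ => 1) ^ n := by
  induction n with
  | zero => exact lagrangeSeries_zero C hC
  | succ n ih => rw [pow_succ', ← ih, ← lagrangeSeries_add C hC]; rfl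

end LagrangeSeries

section ClassicalLimit

variable {m : ℕ}

lemma qPochhammer_succ (a q : ℝ) (n : ℕ) :
    qPochhammer a q (n + 1) = qPochhammer a q n * (1 - a * q ^ n) :=
  Finset.prod_range_succ _ _

lemma one_sub_sq_mul_sq_pow_ne_zero {q : ℝ} (hq : 0 < q) (hq1 : q ≠ 1) (n : ℕ) :
    1 - q ^ 2 * (q ^ 2) ^ n ≠ 0 := by
  rw [← pow_succ', ← pow_mul, sub_ne_zero, ne_comm, Ne, pow_eq_one_iff_of_nonneg hq.le (by simp)]
  exact hq1

lemma qPochhammer_sq_ne_zero {q : ℝ} (hq : 0 < q) (hq1 : q ≠ 1) (n : ℕ) :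
    qPochhammer (q ^ 2) (q ^ 2) n ≠ 0 :=
  Finset.prod_ne_zero_iff.2 fun k _ => one_sub_sq_mul_sq_pow_ne_zero hq hq1 k

lemma prod_qPochhammer_add_single (a q : ℝ) (d : Fin m →₀ ℕ) (k : Fin m) :
    ∏ i, qPochhammer a q ((d + Finsupp.single k 1 : Fin m →₀ ℕ) i) =
      (∏ i, qPochhammer a q (d i)) * (1 - a * q ^ d k) := by
  have factor (i : Fin m) : qPochhammer a q ((d + Finsupp.single k 1 : Fin m →₀ ℕ) i) =
      qPochhammer a q (d i) * if k = i then 1 - a * q ^ d i else 1 := by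
    rw [Finsupp.add_apply, Finsupp.single_apply]
    split_ifs <;> simp only [qPochhammer_succ, add_zero, mul_one]
  simp only [factor, Finset.prod_mul_distrib, Finset.prod_ite_eq, Finset.mem_univ, if_true]

lemma quadraticForm_add_single (C : Matrix (Fin m) (Fin m) ℕ) (hC : C.IsSymm) (d : Fin m →₀ ℕ)
    (k : Fin m) :
    ∑ i, ∑ j, C i j * (d + Finsupp.single k 1 : Fin m →₀ ℕ) i *
        (d + Finsupp.single k 1 : Fin m →₀ ℕ) j =
      (∑ i, ∑ j, C i j * d i * d j) + 2 * (∑ i, C k i * d i) + C k k := by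
  simp only [Finsupp.add_apply, Finsupp.single_apply, mul_add, add_mul, Finset.sum_add_distrib,
    mul_ite, ite_mul, mul_one, mul_zero, zero_mul, Finset.sum_ite_eq, Finset.mem_univ, if_true,
    Finset.sum_ite_irrel, Finset.sum_const_zero, hC.apply k]
  ring

lemma constantCoeff_motivicSeries (C : Matrix (Fin m) (Fin m) ℕ) (q : ℝ) :
    MvPowerSeries.constantCoeff (motivicSeries C q) = 1 := by
  rw [← MvPowerSeries.coeff_zero_eq_constantCoeff_apply, MvPowerSeries.coeff_apply]
  simp [motivicSeries, qPochhammer]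

lemma coeff_motivicSeries_add_single (C : Matrix (Fin m) (Fin m) ℕ) (hC : C.IsSymm) {q : ℝ}
    (hq : 0 < q) (hq1 : q ≠ 1) (d : Fin m →₀ ℕ) (k : Fin m) :
    (1 - q ^ 2 * (q ^ 2) ^ d k) *
        MvPowerSeries.coeff (d + Finsupp.single k 1) (motivicSeries C q) =
      (-q) ^ C k k * (q ^ 2) ^ (∑ i, C k i * d i) * MvPowerSeries.coeff d (motivicSeries C q) := by
  have factor_ne_zero := one_sub_sq_mul_sq_pow_ne_zero hq hq1 (d k)
  have prod_ne_zero : ∏ i, qPochhammer (q ^ 2) (q ^ 2) (d i) ≠ 0 :=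
    Finset.prod_ne_zero_iff.2 fun i _ => qPochhammer_sq_ne_zero hq hq1 (d i)
  simp only [MvPowerSeries.coeff_apply, motivicSeries]
  rw [prod_qPochhammer_add_single, quadraticForm_add_single C hC, pow_add, pow_add, pow_mul, neg_sq]
  field_simp

/-- The quotient `P_C(q ^ (2 c_1) x_1, …, q ^ (2 c_m) x_m) / P_C(x_1, …, x_m)`. -/
noncomputable def shiftedQuotient (C : Matrix (Fin m) (Fin m) ℕ) (q : ℝ) (c : Fin m → ℕ) :
    MvPowerSeries (Fin m) ℝ :=
  MvPowerSeries.rescale (fun i => (q ^ 2) ^ c i) (motivicSeries C q) * (motivicSeries C q)⁻¹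

lemma shiftedQuotient_zero (C : Matrix (Fin m) (Fin m) ℕ) (q : ℝ) :
    shiftedQuotient C q 0 = 1 := by
  simp only [shiftedQuotient, Pi.zero_apply, pow_zero]
  rw [← Pi.one_def, MvPowerSeries.rescale_one, RingHom.id_apply,
    MvPowerSeries.mul_inv_cancel _ (by simp [constantCoeff_motivicSeries])]

lemma shiftedQuotient_one (C : Matrix (Fin m) (Fin m) ℕ) (q : ℝ) :
    shiftedQuotient C q (fun _ => 1) = quotientSeries C q := by
  simp only [shiftedQuotient, quotientSeries, pow_one]

lemma coeff_rescale_pow (q : ℝ) (c : Fin m → ℕ) (l : Fin m →₀ ℕ) (f : MvPowerSeries (Fin m) ℝ) :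
    MvPowerSeries.coeff l (MvPowerSeries.rescale (fun i => q ^ c i) f) =
      q ^ (∑ i, c i * l i) * MvPowerSeries.coeff l f := by
  rw [MvPowerSeries.coeff_rescale, Finsupp.prod_fintype _ _ (by simp), ← Finset.prod_pow_eq_pow_sum]
  simp only [pow_mul]

lemma shiftRecurrence_rescale_motivicSeries (C : Matrix (Fin m) (Fin m) ℕ) (hC : C.IsSymm)
    {q : ℝ} (hq : 0 < q) (hq1 : q ≠ 1) :
    ShiftRecurrence C (fun c j => (-q) ^ C j j * (q ^ 2) ^ c j)
      fun c => MvPowerSeries.rescale (fun i => (q ^ 2) ^ c i) (motivicSeries C q) := by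
  intro c j
  ext l
  simp only [map_sub, MvPowerSeries.coeff_C_mul, MvPowerSeries.X,
    MvPowerSeries.coeff_monomial_mul, one_mul, coeff_rescale_pow, Pi.add_apply, add_mul,
    Finset.sum_add_distrib, Pi.single_apply, ite_mul, zero_mul, Finset.sum_ite_eq',
    Finset.mem_univ, if_true]
  split_ifs with hl
  · obtain ⟨l, rfl⟩ := exists_add_of_le hl
    rw [add_comm _ l, add_tsub_cancel_right]
    simp only [Finsupp.add_apply, Finsupp.single_apply, mul_add, Finset.sum_add_distrib, mul_ite,
      mul_one, mul_zero, Finset.sum_ite_eq, Finset.mem_univ, if_true, pow_add, pow_one]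
    linear_combination -((q ^ 2) ^ (∑ i, c i * l i) * (q ^ 2) ^ c j) *
      coeff_motivicSeries_add_single C hC hq hq1 l j
  · rw [Finsupp.single_le_iff, Nat.one_le_iff_ne_zero, not_not] at hl
    rw [hl, add_zero, mul_zero, sub_zero]

lemma eventually_pos_and_ne_one : ∀ᶠ q : ℝ in 𝓝[≠] 1, 0 < q ∧ q ≠ 1 :=
  ((lt_mem_nhds one_pos).filter_mono nhdsWithin_le_nhds).and eventually_mem_nhdsWithin

lemma tendsto_shiftedQuotient (C : Matrix (Fin m) (Fin m) ℕ) (hC : C.IsSymm) (c : Fin m → ℕ) :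
    Tendsto (fun q => shiftedQuotient C q c) (𝓝[≠] 1)
      (𝓝 (MvPowerSeries.map (Int.castRingHom ℝ) (lagrangeSeries C c))) := by
  refine ShiftRecurrence.tendsto (a := fun q c j => (-q) ^ C j j * (q ^ 2) ^ c j) ?_
    ((shiftRecurrence_lagrangeSeries C).map (Int.castRingHom ℝ)) (fun c j => ?_) ?_ c
  · filter_upwards [eventually_pos_and_ne_one] with q ⟨hq, hq1⟩
    exact (shiftRecurrence_rescale_motivicSeries C hC hq hq1).mul_right _
  · have continuous_coeff : Continuous fun q : ℝ => (-q) ^ C j j * (q ^ 2) ^ c j := by fun_prop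
    simpa using (continuous_coeff.tendsto 1).mono_left nhdsWithin_le_nhds
  · simp only [shiftedQuotient_zero, lagrangeSeries_zero C hC, map_one]
    exact tendsto_const_nhds

/-- The limit of `P_C(q² x) / P_C(x)` as `q → 1`. -/
noncomputable def classicalLimit (C : Matrix (Fin m) (Fin m) ℕ) : MvPowerSeries (Fin m) ℝ :=
  MvPowerSeries.map (Int.castRingHom ℝ) (lagrangeSeries C fun _ => 1)

theorem isClassicalLimit_classicalLimit (C : Matrix (Fin m) (Fin m) ℕ) (hC : C.IsSymm) :
    IsClassicalLimit C (classicalLimit C) := by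
  have tendsto_quotient := tendsto_shiftedQuotient C hC fun _ => 1
  simp only [shiftedQuotient_one] at tendsto_quotient
  exact (MvPowerSeries.WithPiTopology.tendsto_iff_coeff_tendsto _ _ _).1 tendsto_quotient

lemma constantCoeff_classicalLimit (C : Matrix (Fin m) (Fin m) ℕ) :
    MvPowerSeries.constantCoeff (classicalLimit C) = 1 := by
  rw [classicalLimit, MvPowerSeries.constantCoeff_map, constantCoeff_lagrangeSeries, map_one]

lemma coeff_classicalLimit_pow (C : Matrix (Fin m) (Fin m) ℕ) (hC : C.IsSymm) (n : ℕ)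
    (l : Fin m →₀ ℕ) :
    MvPowerSeries.coeff l (classicalLimit C ^ n) = (-1) ^ signExponent C l *
      (lagrangeMatrix (C.map Nat.cast)
        (fun i => (n : ℝ) + linForm (C.map Nat.cast) l i) l).det := by
  rw [classicalLimit, ← map_pow, ← lagrangeSeries_const C hC, MvPowerSeries.coeff_map,
    coeff_lagrangeSeries, map_mul, map_det_lagrangeMatrix, map_pow, map_neg, map_one,
    Matrix.map_map]
  congr 3
  ext i
  simp [linForm]

end ClassicalLimit

section MatrixTree

variable {m : ℕ}

/-- The set of pairs `(p j, j)` for a partial parent function `p` on the vertices, where `none` is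
the parent of a root. -/
def parentGraph (p : Fin m → Option (Fin m)) : Finset (Fin m × Fin m) :=
  {e | p e.2 = some e.1}

lemma mem_parentGraph {p : Fin m → Option (Fin m)} {e : Fin m × Fin m} :
    e ∈ parentGraph p ↔ p e.2 = some e.1 := by
  simp [parentGraph]

lemma parentGraph_injective : Function.Injective (parentGraph (m := m)) := by
  intro p p' h
  ext j i
  simpa [mem_parentGraph] using Finset.ext_iff.1 h (i, j)

lemma eq_of_mem_parentGraph {p : Fin m → Option (Fin m)} {e e' : Fin m × Fin m}
    (he : e ∈ parentGraph p) (he' : e' ∈ parentGraph p) (h : e.2 = e'.2) : e = e' := by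
  rw [mem_parentGraph] at he he'
  exact Prod.ext (Option.some.inj (by rw [← he, ← he', h])) h

lemma exists_parentGraph_eq {S : Finset (Fin m × Fin m)}
    (hS : ∀ e ∈ S, ∀ e' ∈ S, e.2 = e'.2 → e = e') : ∃ p, parentGraph p = S := by
  have exists_parent (j : Fin m) : ∃ o : Option (Fin m), ∀ i, o = some i ↔ (i, j) ∈ S := by
    by_cases hj : ∃ i, (i, j) ∈ S
    · obtain ⟨i, hi⟩ := hj
      refine ⟨some i, fun i' => ⟨?_, fun hi' => ?_⟩⟩
      · rintro ⟨⟩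
        exact hi
      · rw [(Prod.mk.inj (hS _ hi _ hi' rfl)).1]
    · push Not at hj
      exact ⟨none, by simpa using hj⟩
  choose p hp using exists_parent
  exact ⟨p, Finset.ext fun e => by rw [mem_parentGraph, hp]⟩

/-- A cycle of parents `u 0, u 1, …` is a cycle of pairs in the sense of `IsAdmissible` when it is
traversed backwards, from parents to children. -/
lemma not_isAdmissible_parentGraph_of_cycle {p : Fin m → Option (Fin m)} {n : ℕ}
    {u : Fin (n + 1) → Fin m} (hu : Function.Injective u) (hp : ∀ s, p (u s) = some (u (s + 1))) :
    ¬ IsAdmissible (parentGraph p) := fun h => by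
  refine h.2 n (fun t => (u (-t + 1), u (-t))) (fun t t' htt => ?_)
    (fun t => mem_parentGraph.2 (hp _)) fun t => ?_
  · exact neg_injective (hu (Prod.mk.inj htt).2)
  · simp only [neg_add_rev, neg_add_cancel_comm]

lemma exists_cycle_of_iterate_ne_none {p : Fin m → Option (Fin m)} {j : Fin m}
    (hne : ∀ k, (·.bind p)^[k] (some j) ≠ none) :
    ∃ (n : ℕ) (u : Fin (n + 1) → Fin m),
      Function.Injective u ∧ ∀ s, p (u s) = some (u (s + 1)) := by
  set F : Option (Fin m) → Option (Fin m) := (·.bind p)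
  obtain ⟨a, b, hab, heq⟩ : ∃ a b, a < b ∧ F^[a] (some j) = F^[b] (some j) := by
    obtain ⟨a, b, hab, heq⟩ := Finite.exists_ne_map_eq_of_infinite fun k => F^[k] (some j)
    exact hab.lt_or_gt.elim (fun h => ⟨a, b, h, heq⟩) fun h => ⟨b, a, h, heq.symm⟩
  set z := F^[a] (some j) with hz
  have z_periodic : z ∈ Function.periodicPts F := by
    refine ⟨b - a, Nat.sub_pos_of_lt hab, ?_⟩
    rw [Function.IsPeriodicPt, Function.IsFixedPt, hz, ← Function.iterate_add_apply,
      Nat.sub_add_cancel hab.le, ← heq]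
  obtain ⟨n, hn⟩ : ∃ n, Function.minimalPeriod F z = n + 1 :=
    Nat.exists_eq_succ_of_ne_zero (Function.minimalPeriod_pos_of_mem_periodicPts z_periodic).ne'
  have iterate_eq_some (k : ℕ) : ∃ v, F^[k] z = some v := by
    rw [← Option.ne_none_iff_exists', hz, ← Function.iterate_add_apply]
    exact hne _
  choose v hv using iterate_eq_some
  refine ⟨n, fun s => v s, fun s s' hss => ?_, fun s => ?_⟩
  · refine Fin.ext (Function.iterate_injOn_Iio_minimalPeriod (f := F) (x := z) ?_ ?_ ?_)
    · simpa only [hn, Set.mem_Iio] using s.2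
    · simpa only [hn, Set.mem_Iio] using s'.2
    · simp only [hv, hss]
  · have val_add_one : ((s + 1 : Fin (n + 1)) : ℕ) = (s + 1) % (n + 1) := by
      simp [Fin.val_add]
    have wrap : F^[(s + 1) % (n + 1)] z = F^[s + 1] z := by
      simpa only [hn] using Function.iterate_mod_minimalPeriod_eq (f := F) (x := z) (n := s + 1)
    have step : F^[s + 1] z = p (v s) := by
      rw [Function.iterate_succ_apply', hv]
      rfl
    rw [← hv, val_add_one, wrap, step]

lemma exists_iterate_parent_eq_none {p : Fin m → Option (Fin m)}
    (hp : IsAdmissible (parentGraph p)) (j : Fin m) : ∃ k, (·.bind p)^[k] (some j) = none := by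
  by_contra! hne
  obtain ⟨n, u, hu, hstep⟩ := exists_cycle_of_iterate_ne_none hne
  exact not_isAdmissible_parentGraph_of_cycle hu hstep hp

lemma iterate_bind_none (p : Fin m → Option (Fin m)) (k : ℕ) : (·.bind p)^[k] none = none :=
  Function.iterate_fixed rfl k

lemma exists_parent_eq_none [NeZero m] {p : Fin m → Option (Fin m)}
    (hp : IsAdmissible (parentGraph p)) : ∃ r, p r = none := by
  obtain ⟨k, hk⟩ := exists_iterate_parent_eq_none hp 0
  by_contra! hne
  have iterate_ne_none (k : ℕ) : (·.bind p)^[k] (some 0) ≠ none := by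
    induction k with
    | zero => simp
    | succ k ih =>
      obtain ⟨v, hv⟩ := Option.ne_none_iff_exists'.1 ih
      rw [Function.iterate_succ_apply', hv]
      exact hne v
  exact iterate_ne_none k hk

lemma IsAdmissible.card_le {S : Finset (Fin m × Fin m)} (hS : IsAdmissible S) :
    S.card ≤ m - 1 := by
  obtain rfl | hm := Nat.eq_zero_or_pos m
  · simp [Finset.eq_empty_of_isEmpty S]
  have : NeZero m := .of_pos hm
  obtain ⟨p, rfl⟩ := exists_parentGraph_eq hS.1
  obtain ⟨r, hr⟩ := exists_parent_eq_none hS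
  have snd_mem : Set.MapsTo Prod.snd (parentGraph p : Set (Fin m × Fin m)) (univ.erase r) := by
    intro e he
    have : e.2 ≠ r := by
      rintro rfl
      simp [mem_parentGraph, hr] at he
    simpa using this
  simpa using Finset.card_le_card_of_injOn Prod.snd snd_mem
    fun e he e' he' => eq_of_mem_parentGraph he he'

lemma exists_isAdmissible_card_eq (m : ℕ) :
    ∃ S : Finset (Fin m × Fin m), IsAdmissible S ∧ S.card = m - 1 := by
  cases m with
  | zero => exact ⟨∅, ⟨by simp, fun n f _ hf => absurd (hf 0) (by simp)⟩, rfl⟩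
  | succ m =>
    refine ⟨univ.image fun j : Fin m => (0, j.succ), ⟨?_, fun n f _ hf hcycle => ?_⟩, ?_⟩
    · simp
    · obtain ⟨j, -, hj⟩ := Finset.mem_image.1 (hf 0)
      obtain ⟨j', -, hj'⟩ := Finset.mem_image.1 (hf (0 + 1))
      have succ_eq_zero := hcycle 0
      rw [← hj, ← hj'] at succ_eq_zero
      exact Fin.succ_ne_zero j succ_eq_zero
    · rw [Finset.card_image_of_injective _ fun a b h => by simpa using h]
      simp

/-- The matrix over `R` whose `j`-th row is the unit vector of the parent of `j`, or zero if `j` is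
a root. -/
def parentMatrix (R : Type*) [Zero R] [One R] (p : Fin m → Option (Fin m)) :
    Matrix (Fin m) (Fin m) R :=
  fun j i => if p j = some i then 1 else 0

lemma parentMatrix_pow_apply (p : Fin m → Option (Fin m)) (k : ℕ) (j i : Fin m) :
    (parentMatrix ℤ p ^ k) j i = if (·.bind p)^[k] (some j) = some i then 1 else 0 := by
  induction k generalizing j with
  | zero => simp [Matrix.one_apply]
  | succ k ih =>
    rw [pow_succ', Matrix.mul_apply]
    simp only [ih, Function.iterate_succ_apply, Option.bind_some, parentMatrix]
    obtain hj | ⟨i', hj⟩ := (p j).eq_none_or_eq_some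
    · simp [hj, iterate_bind_none]
    · simp only [hj, Option.some.injEq, ite_mul, one_mul, zero_mul, Finset.sum_ite_eq,
        Finset.mem_univ, if_true]

lemma det_one_sub_parentMatrix_of_isAdmissible {p : Fin m → Option (Fin m)}
    (hp : IsAdmissible (parentGraph p)) : (1 - parentMatrix ℤ p).det = 1 := by
  have nilpotent : IsNilpotent (parentMatrix ℤ p) := by
    choose k hk using exists_iterate_parent_eq_none hp
    refine ⟨∑ j, k j, ?_⟩
    ext j i
    rw [parentMatrix_pow_apply,
      ← Nat.sub_add_cancel (Finset.single_le_sum (fun _ _ => Nat.zero_le _) (Finset.mem_univ j)),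
      Function.iterate_add_apply, hk, iterate_bind_none]
    simp
  have charpoly_eq : (parentMatrix ℤ p).charpoly = Polynomial.X ^ Fintype.card (Fin m) :=
    sub_eq_zero.1 (Matrix.isNilpotent_charpoly_sub_pow_of_isNilpotent nilpotent).eq_zero
  simpa [charpoly_eq] using (Matrix.eval_charpoly (parentMatrix ℤ p) 1).symm

/-- Counting how often a cycle passes through each vertex gives a left null vector. -/
lemma det_one_sub_parentMatrix_of_not_isAdmissible {p : Fin m → Option (Fin m)}
    (hp : ¬ IsAdmissible (parentGraph p)) : (1 - parentMatrix ℤ p).det = 0 := by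
  obtain ⟨n, f, hf, hcycle⟩ : ∃ (n : ℕ) (f : Fin (n + 1) → Fin m × Fin m),
      (∀ t, f t ∈ parentGraph p) ∧ ∀ t, (f t).2 = (f (t + 1)).1 := by
    by_contra! hacyclic
    refine hp ⟨fun e he e' he' => eq_of_mem_parentGraph he he', fun n f _ hf hcycle => ?_⟩
    obtain ⟨t, ht⟩ := hacyclic n f hf
    exact ht (hcycle t)
  refine Matrix.exists_vecMul_eq_zero_iff.1
    ⟨fun j => ∑ t, if (f t).2 = j then 1 else 0, fun h => ?_, ?_⟩
  · have count_eq_zero := congrFun h (f 0).2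
    rw [Pi.zero_apply, Finset.sum_eq_zero_iff_of_nonneg fun t _ => by positivity] at count_eq_zero
    simpa using count_eq_zero 0 (Finset.mem_univ 0)
  · ext i
    have row (t : Fin (n + 1)) : (1 - parentMatrix ℤ p) (f t).2 i =
        (if (f (t + 1)).1 = i then 1 else 0) - if (f t).1 = i then 1 else 0 := by
      simp only [parentMatrix, mem_parentGraph.1 (hf t), Matrix.sub_apply, Matrix.one_apply,
        ← hcycle t, Option.some.injEq]
    simp only [Matrix.vecMul, dotProduct, Finset.sum_mul, ite_mul, one_mul, zero_mul]
    rw [Finset.sum_comm]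
    simp only [Finset.sum_ite_eq, Finset.mem_univ, if_true, row, Finset.sum_sub_distrib]
    exact sub_eq_zero.2 (Equiv.sum_comp (Equiv.addRight (1 : Fin (n + 1)))
      fun t => if (f t).1 = i then (1 : ℤ) else 0)

variable {R : Type*} [CommRing R]

open Classical in
lemma det_one_sub_parentMatrix (p : Fin m → Option (Fin m)) :
    (1 - parentMatrix R p).det = if IsAdmissible (parentGraph p) then 1 else 0 := by
  have map_eq : 1 - parentMatrix R p = (1 - parentMatrix ℤ p).map (Int.castRingHom R) := by
    ext j i
    simp [parentMatrix, Matrix.one_apply]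
  rw [map_eq, ← RingHom.mapMatrix_apply, ← RingHom.map_det]
  split_ifs with hp
  · rw [det_one_sub_parentMatrix_of_isAdmissible hp, map_one]
  · rw [det_one_sub_parentMatrix_of_not_isAdmissible hp, map_zero]

lemma prod_elim_parent (p : Fin m → Option (Fin m)) (x : R) (w : Matrix (Fin m) (Fin m) R) :
    ∏ j, (p j).elim x (fun i => w i j) =
      x ^ (m - (parentGraph p).card) * ∏ e ∈ parentGraph p, w e.1 e.2 := by
  have prod_edges : ∏ e ∈ parentGraph p, w e.1 e.2 = ∏ j, (p j).elim 1 (fun i => w i j) := by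
    rw [parentGraph, Finset.prod_filter, Fintype.prod_prod_type_right]
    refine Finset.prod_congr rfl fun j _ => ?_
    cases hj : p j <;> simp [hj]
  have card_edges : (parentGraph p).card = ∑ j, (p j).elim 0 (fun _ => 1) := by
    rw [parentGraph, Finset.card_filter, Fintype.sum_prod_type_right]
    refine Finset.sum_congr rfl fun j _ => ?_
    cases hj : p j <;> simp [hj]
  have card_roots : m - (parentGraph p).card = ∑ j, (p j).elim 1 (fun _ => 0) := by
    have root_or_child (j : Fin m) : (p j).elim 1 (fun _ => 0) + (p j).elim 0 (fun _ => 1) = 1 := by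
      cases p j <;> rfl
    refine Nat.sub_eq_of_eq_add ?_
    rw [card_edges, ← Finset.sum_add_distrib]
    simp [root_or_child]
  rw [prod_edges, card_roots, ← Finset.prod_pow_eq_pow_sum, ← Finset.prod_mul_distrib]
  refine Finset.prod_congr rfl fun j _ => ?_
  cases p j <;> simp

/-- The `j`-th column of the Laplacian is the sum over the possible parents of `j`. -/
lemma det_laplacian_eq_sum_parent (x : R) (w : Matrix (Fin m) (Fin m) R) :
    (Matrix.diagonal (fun j => x + ∑ k, w k j) - w).det =
      ∑ p : Fin m → Option (Fin m),
        (∏ j, (p j).elim x (fun i => w i j)) * (1 - parentMatrix R p).det := by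
  have transpose_eq : (Matrix.diagonal (fun j => x + ∑ k, w k j) - w).transpose =
      fun j => ∑ o : Option (Fin m), (o.elim x (fun i => w i j)) •
        (fun i => (if j = i then (1 : R) else 0) - if o = some i then 1 else 0) := by
    ext j i
    simp only [Matrix.transpose_apply, Matrix.sub_apply, Matrix.diagonal_apply, Finset.sum_apply,
      Pi.smul_apply, smul_eq_mul, Fintype.sum_option, Option.elim_none, Option.elim_some, mul_sub,
      Finset.sum_sub_distrib, reduceCtorEq, if_false, Option.some.injEq]
    obtain rfl | hji := eq_or_ne j i
    · simp
    · simp [hji, hji.symm]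
  rw [← Matrix.det_transpose, transpose_eq]
  change Matrix.detRowAlternating.toMultilinearMap _ = _
  rw [MultilinearMap.map_sum]
  refine Finset.sum_congr rfl fun p _ => ?_
  rw [MultilinearMap.map_smul_univ, smul_eq_mul]
  congr 2

open Classical in
theorem det_laplacian (x : R) (w : Matrix (Fin m) (Fin m) R) :
    (Matrix.diagonal (fun j => x + ∑ k, w k j) - w).det =
      ∑ S : Finset (Fin m × Fin m) with IsAdmissible S,
        x ^ (m - S.card) * ∏ e ∈ S, w e.1 e.2 := by
  simp only [det_laplacian_eq_sum_parent, prod_elim_parent, det_one_sub_parentMatrix, mul_ite,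
    mul_one, mul_zero]
  rw [← Finset.sum_filter]
  refine Finset.sum_nbij parentGraph ?_ parentGraph_injective.injOn ?_ fun _ _ => rfl
  · intro p hp
    simpa using hp
  · intro S hS
    have hS : IsAdmissible S := by simpa using hS
    obtain ⟨p, rfl⟩ := exists_parentGraph_eq hS.1
    exact ⟨p, by simpa using hS, rfl⟩

end MatrixTree

section PrincipalUnits

lemma map_prod_zpow_of_map_mul {G A ι : Type*} [CommGroup G] [AddCommGroup A] {H : Subgroup G}
    {φ : G → A} (map_mul : ∀ u ∈ H, ∀ v ∈ H, φ (u * v) = φ u + φ v) (s : Finset ι) {u : ι → G}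
    (hu : ∀ i ∈ s, u i ∈ H) (k : ι → ℤ) :
    φ (∏ i ∈ s, u i ^ k i) = ∑ i ∈ s, k i • φ (u i) := by
  let Φ : Additive H →+ A :=
    AddMonoidHom.mk' (fun u => φ u.toMul) fun u v => map_mul _ u.toMul.2 _ v.toMul.2
  have coe_sum : φ (∏ i ∈ s, u i ^ k i) = Φ (∑ i : s, k i • Additive.ofMul ⟨u i, hu i i.2⟩) := by
    rw [AddMonoidHom.mk'_apply, toMul_sum, Subgroup.val_finsetProd]
    exact congrArg φ (Finset.prod_coe_sort s fun i => u i ^ k i).symm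
  rw [coe_sum, map_sum, ← Finset.sum_coe_sort s]
  simp only [map_zsmul]
  rfl

variable {σ R : Type*} [CommRing R]

lemma coeff_mul_congr_of_degree_le {f g : MvPowerSeries σ R} {n : ℕ}
    (hfg : ∀ l : σ →₀ ℕ, l.degree ≤ n → MvPowerSeries.coeff l f = MvPowerSeries.coeff l g)
    (h : MvPowerSeries σ R) {l : σ →₀ ℕ} (hl : l.degree ≤ n) :
    MvPowerSeries.coeff l (h * f) = MvPowerSeries.coeff l (h * g) := by
  classical
  simp only [MvPowerSeries.coeff_mul]
  refine Finset.sum_congr rfl fun p hp => ?_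
  rw [← Finset.HasAntidiagonal.mem_antidiagonal.1 hp, map_add] at hl
  rw [hfg p.2 (by omega)]

variable (σ R) in
/-- The group of the power series that agree with `1` up to degree `n`. -/
def principalUnits (n : ℕ) : Subgroup (MvPowerSeries σ R)ˣ where
  carrier := {u | ∀ l : σ →₀ ℕ, l.degree ≤ n →
    MvPowerSeries.coeff l (u : MvPowerSeries σ R) = MvPowerSeries.coeff l 1}
  one_mem' _ _ := rfl
  mul_mem' {u v} hu hv l hl := by
    rw [Units.val_mul, coeff_mul_congr_of_degree_le hv _ hl, mul_one, hu l hl]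
  inv_mem' {u} hu l hl := by
    rw [← mul_one (u⁻¹ : (MvPowerSeries σ R)ˣ).val,
      ← coeff_mul_congr_of_degree_le hu _ hl, Units.inv_mul]

lemma mem_principalUnits {n : ℕ} {u : (MvPowerSeries σ R)ˣ} :
    u ∈ principalUnits σ R n ↔ ∀ l : σ →₀ ℕ, l.degree ≤ n →
      MvPowerSeries.coeff l (u : MvPowerSeries σ R) = MvPowerSeries.coeff l 1 :=
  Iff.rfl

lemma mem_principalUnits_zero {u : (MvPowerSeries σ R)ˣ} :
    u ∈ principalUnits σ R 0 ↔ MvPowerSeries.constantCoeff (u : MvPowerSeries σ R) = 1 := by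
  simp [mem_principalUnits, Finsupp.degree_eq_zero_iff]

lemma mem_principalUnits_succ {n : ℕ} {u : (MvPowerSeries σ R)ˣ} :
    u ∈ principalUnits σ R (n + 1) ↔ u ∈ principalUnits σ R n ∧
      ∀ l : σ →₀ ℕ, l.degree = n + 1 → MvPowerSeries.coeff l (u : MvPowerSeries σ R) = 0 := by
  simp only [mem_principalUnits, Nat.le_succ_iff, or_imp, forall_and]
  refine and_congr_right fun _ => forall₂_congr fun l hl => ?_
  classical
  rw [MvPowerSeries.coeff_one, if_neg]
  rintro rfl
  simp at hl

lemma coeff_mul_of_mem_principalUnits {n : ℕ} {u v : (MvPowerSeries σ R)ˣ}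
    (hu : u ∈ principalUnits σ R n) (hv : v ∈ principalUnits σ R n) {l : σ →₀ ℕ}
    (hl : l.degree = n + 1) :
    MvPowerSeries.coeff l ((u * v : (MvPowerSeries σ R)ˣ) : MvPowerSeries σ R) =
      MvPowerSeries.coeff l (u : MvPowerSeries σ R) +
        MvPowerSeries.coeff l (v : MvPowerSeries σ R) := by
  classical
  have coeff_mul_sub_one :
      MvPowerSeries.coeff l ((u.val - 1) * (v.val - 1)) = 0 := by
    rw [MvPowerSeries.coeff_mul]
    refine Finset.sum_eq_zero fun p hp => ?_
    rw [← Finset.HasAntidiagonal.mem_antidiagonal.1 hp, map_add] at hl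
    obtain h | h : p.1.degree ≤ n ∨ p.2.degree ≤ n := by omega
    · rw [map_sub, hu _ h, sub_self, zero_mul]
    · rw [map_sub _ v.val, hv _ h, sub_self, mul_zero]
  have coeff_one : MvPowerSeries.coeff l (1 : MvPowerSeries σ R) = 0 := by
    rw [MvPowerSeries.coeff_one, if_neg]
    rintro rfl
    simp at hl
  have mul_eq : (u * v).val = (u.val - 1) * (v.val - 1) + u.val + v.val - 1 := by
    rw [Units.val_mul]
    ring
  rw [mul_eq, map_sub, map_add, map_add, coeff_mul_sub_one, coeff_one, zero_add, sub_zero]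

end PrincipalUnits

section Logarithm

variable {σ R K : Type*} [CommRing R] [Field K] [CharZero K]

lemma coeff_sub_one_pow_eq_zero {f : MvPowerSeries σ R} (hf : MvPowerSeries.constantCoeff f = 1)
    {l : σ →₀ ℕ} {k : ℕ} (hk : l.degree < k) : MvPowerSeries.coeff l ((f - 1) ^ k) = 0 :=
  MvPowerSeries.coeff_eq_zero_of_constantCoeff_nilpotent (m := 1) (by simp [hf]) (by omega)

lemma coeff_pow_eq_sum_choose (f : MvPowerSeries σ R) (l : σ →₀ ℕ) {a n : ℕ} (han : a ≤ n) :
    MvPowerSeries.coeff l (f ^ a) =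
      ∑ k ∈ range (n + 1), MvPowerSeries.coeff l ((f - 1) ^ k) * (a.choose k : R) := by
  have binomial : MvPowerSeries.coeff l (f ^ a) =
      ∑ k ∈ range (a + 1), MvPowerSeries.coeff l ((f - 1) ^ k) * (a.choose k : R) := by
    conv_lhs => rw [← sub_add_cancel f 1, add_pow, map_sum]
    refine Finset.sum_congr rfl fun k _ => ?_
    rw [one_pow, mul_one, ← map_natCast MvPowerSeries.C, MvPowerSeries.coeff_mul_C]
  rw [binomial]
  refine Finset.sum_subset (Finset.range_subset_range.2 (by omega)) fun k _ hk => ?_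
  rw [Nat.choose_eq_zero_of_lt (by simpa using hk), Nat.cast_zero, mul_zero]

/-- The logarithm `∑_{k ≥ 1} (-1) ^ (k + 1) (f - 1) ^ k / k` of a power series `f` with constant
term `1`; `logSeries` is the case of finitely many variables over the reals. -/
noncomputable def formalLog (f : MvPowerSeries σ K) : MvPowerSeries σ K :=
  (PowerSeries.log K).subst (f - 1)

lemma coeff_formalLog {f : MvPowerSeries σ K} (hf : MvPowerSeries.constantCoeff f = 1)
    (l : σ →₀ ℕ) :
    MvPowerSeries.coeff l (formalLog f) = ∑ k ∈ range (l.degree + 1),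
      PowerSeries.coeff k (PowerSeries.log K) * MvPowerSeries.coeff l ((f - 1) ^ k) := by
  have hasSubst : PowerSeries.HasSubst (f - 1) :=
    PowerSeries.HasSubst.of_constantCoeff_zero (by rw [map_sub, hf, map_one, sub_self])
  rw [formalLog, PowerSeries.coeff_subst hasSubst]
  refine finsum_eq_sum_of_support_subset _ fun k hk => ?_
  rw [Finset.coe_range, Set.mem_Iio]
  contrapose! hk
  rw [Function.notMem_support, coeff_sub_one_pow_eq_zero hf (by omega), smul_zero]

/-- The polynomial in `a` whose value is the coefficient of `x ^ l` in `f ^ a`, where `f` has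
constant term `1`. -/
noncomputable def powPolynomial (f : MvPowerSeries σ K) (l : σ →₀ ℕ) : Polynomial K :=
  ∑ k ∈ range (l.degree + 1),
    Polynomial.C (MvPowerSeries.coeff l ((f - 1) ^ k)) * Ring.choose Polynomial.X k

lemma eval_choose_X (a : K) (k : ℕ) :
    (Ring.choose (Polynomial.X : Polynomial K) k).eval a = Ring.choose a k := by
  simpa using Ring.map_choose (Polynomial.evalRingHom a) Polynomial.X k

lemma eval_powPolynomial {f : MvPowerSeries σ K} (hf : MvPowerSeries.constantCoeff f = 1)
    (l : σ →₀ ℕ) (a : ℕ) :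
    (powPolynomial f l).eval (a : K) = MvPowerSeries.coeff l (f ^ a) := by
  rw [coeff_pow_eq_sum_choose f l (Nat.le_add_left a l.degree), powPolynomial,
    Polynomial.eval_finsetSum]
  simp only [Polynomial.eval_mul, Polynomial.eval_C, eval_choose_X, Ring.choose_natCast]
  refine Finset.sum_subset (Finset.range_subset_range.2 (by omega)) fun k _ hk => ?_
  rw [coeff_sub_one_pow_eq_zero hf (by simpa using hk), zero_mul]

lemma polynomial_eq_of_eval_natCast {p p' : Polynomial K}
    (h : ∀ a : ℕ, p.eval (a : K) = p'.eval (a : K)) : p = p' := by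
  refine Polynomial.eq_of_infinite_eval_eq _ _ ?_
  refine (Set.infinite_range_of_injective (Nat.cast_injective (R := K))).mono ?_
  rintro _ ⟨a, rfl⟩
  exact h a

lemma choose_neg_one (n : ℕ) : Ring.choose (-1 : K) n = (-1) ^ n := by
  rw [Ring.choose_neg, ← Ring.multichoose_eq, Ring.multichoose_one, Int.negOnePow_def]
  simp [Units.smul_def]

lemma coeff_one_choose_X (k : ℕ) :
    (Ring.choose (Polynomial.X : Polynomial K) k).coeff 1 =
      PowerSeries.coeff k (PowerSeries.log K) := by
  cases k with
  | zero => simp [Polynomial.coeff_one]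
  | succ n =>
    have absorption : ((n + 1 : ℕ) : K) * (Ring.choose Polynomial.X (n + 1)).coeff 1 =
        (Ring.choose (Polynomial.X - 1 : Polynomial K) n).coeff 0 := by
      rw [← Polynomial.coeff_C_mul, map_natCast, natCast_mul_choose, Polynomial.coeff_X_mul,
        choosePred]
    have choose_at_zero :
        (Ring.choose (Polynomial.X - 1 : Polynomial K) n).coeff 0 = (-1) ^ n := by
      rw [Polynomial.coeff_zero_eq_eval_zero, ← Polynomial.coe_evalRingHom, Ring.map_choose]
      simp [choose_neg_one]
    have succ_ne_zero : ((n + 1 : ℕ) : K) ≠ 0 := Nat.cast_ne_zero.2 (Nat.succ_ne_zero n)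
    rw [PowerSeries.coeff_log, if_neg (Nat.succ_ne_zero n), eq_ratCast]
    push_cast at absorption succ_ne_zero ⊢
    rw [eq_div_iff succ_ne_zero, mul_comm, absorption, choose_at_zero]
    ring

/-- The coefficient of `f ^ a = exp (a log f)` is a polynomial in `a` with this linear term. -/
lemma coeff_one_powPolynomial {f : MvPowerSeries σ K} (hf : MvPowerSeries.constantCoeff f = 1)
    (l : σ →₀ ℕ) : (powPolynomial f l).coeff 1 = MvPowerSeries.coeff l (formalLog f) := by
  rw [coeff_formalLog hf, powPolynomial, Polynomial.finsetSum_coeff]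
  refine Finset.sum_congr rfl fun k _ => ?_
  rw [Polynomial.coeff_C_mul, coeff_one_choose_X, mul_comm]

lemma coeff_zero_powPolynomial {f : MvPowerSeries σ K} (hf : MvPowerSeries.constantCoeff f = 1)
    (l : σ →₀ ℕ) : (powPolynomial f l).coeff 0 = MvPowerSeries.coeff l 1 := by
  simpa [Polynomial.coeff_zero_eq_eval_zero] using eval_powPolynomial hf l 0

lemma formalLog_mul {f g : MvPowerSeries σ K} (hf : MvPowerSeries.constantCoeff f = 1)
    (hg : MvPowerSeries.constantCoeff g = 1) :
    formalLog (f * g) = formalLog f + formalLog g := by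
  classical
  ext l
  have hfg : MvPowerSeries.constantCoeff (f * g) = 1 := by rw [map_mul, hf, hg, one_mul]
  have powPolynomial_mul : powPolynomial (f * g) l =
      ∑ p ∈ antidiagonal l, powPolynomial f p.1 * powPolynomial g p.2 := by
    refine polynomial_eq_of_eval_natCast fun a => ?_
    rw [eval_powPolynomial hfg, Polynomial.eval_finsetSum, mul_pow, MvPowerSeries.coeff_mul]
    simp only [Polynomial.eval_mul, eval_powPolynomial hf, eval_powPolynomial hg]
  rw [← coeff_one_powPolynomial hfg, powPolynomial_mul, Polynomial.finsetSum_coeff]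
  simp only [Polynomial.mul_coeff_one, coeff_zero_powPolynomial hf, coeff_zero_powPolynomial hg,
    coeff_one_powPolynomial hf, coeff_one_powPolynomial hg, Finset.sum_add_distrib]
  rw [← MvPowerSeries.coeff_mul, ← MvPowerSeries.coeff_mul, one_mul, mul_one, map_add, add_comm]

lemma formalLog_prod_zpow {ι : Type*} (s : Finset ι) {u : ι → (MvPowerSeries σ K)ˣ}
    (hu : ∀ i ∈ s, u i ∈ principalUnits σ K 0) (k : ι → ℤ) :
    formalLog ((∏ i ∈ s, u i ^ k i : (MvPowerSeries σ K)ˣ) : MvPowerSeries σ K) =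
      ∑ i ∈ s, k i • formalLog (u i : MvPowerSeries σ K) :=
  map_prod_zpow_of_map_mul (H := principalUnits σ K 0) (φ := fun u => formalLog u.val)
    (fun _ hu _ hv => formalLog_mul (mem_principalUnits_zero.1 hu) (mem_principalUnits_zero.1 hv))
    s hu k

lemma continuousOn_formalLog [TopologicalSpace K] [IsTopologicalRing K] :
    ContinuousOn (formalLog (σ := σ) (K := K)) {f | MvPowerSeries.constantCoeff f = 1} := by
  refine continuousOn_pi.2 fun l => ?_
  refine ContinuousOn.congr (f := fun f => ∑ k ∈ range (l.degree + 1),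
    PowerSeries.coeff k (PowerSeries.log K) * MvPowerSeries.coeff l ((f - 1) ^ k))
    (Continuous.continuousOn ?_) fun f hf => coeff_formalLog hf l
  refine continuous_finsetSum _ fun k _ => continuous_const.mul ?_
  exact (MvPowerSeries.WithPiTopology.continuous_coeff K l).comp (by fun_prop)

end Logarithm

section OneSubMonomial

variable {σ R S : Type*} [CommRing R] [CommRing S]

lemma constantCoeff_one_sub_monomial (d : {d : σ →₀ ℕ // d ≠ 0}) :
    MvPowerSeries.constantCoeff (1 - MvPowerSeries.monomial d.1 (1 : R)) = 1 := by
  classical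
  rw [map_sub, map_one, ← MvPowerSeries.coeff_zero_eq_constantCoeff_apply,
    MvPowerSeries.coeff_monomial_ne d.2.symm, sub_zero]

variable (R) in
/-- The factor `1 - x ^ d` of an Euler product, as an invertible power series. -/
noncomputable def oneSubMonomial (d : {d : σ →₀ ℕ // d ≠ 0}) : (MvPowerSeries σ R)ˣ :=
  Units.mkOfMulEqOne (1 - MvPowerSeries.monomial d.1 1) _
    (MvPowerSeries.mul_invOfUnit _ 1 (constantCoeff_one_sub_monomial d))

lemma coe_oneSubMonomial (d : {d : σ →₀ ℕ // d ≠ 0}) :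
    (oneSubMonomial R d : MvPowerSeries σ R) = 1 - MvPowerSeries.monomial d.1 1 :=
  rfl

lemma map_oneSubMonomial (f : R →+* S) (d : {d : σ →₀ ℕ // d ≠ 0}) :
    Units.map (MvPowerSeries.map f).toMonoidHom (oneSubMonomial R d) = oneSubMonomial S d := by
  ext1
  simp [coe_oneSubMonomial, MvPowerSeries.map_monomial]

lemma coeff_oneSubMonomial [DecidableEq σ] (d : {d : σ →₀ ℕ // d ≠ 0}) (l : σ →₀ ℕ) :
    MvPowerSeries.coeff l (oneSubMonomial R d : MvPowerSeries σ R) =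
      MvPowerSeries.coeff l 1 - if l = d then 1 else 0 := by
  rw [coe_oneSubMonomial, map_sub, MvPowerSeries.coeff_monomial]

lemma oneSubMonomial_mem_principalUnits {d : {d : σ →₀ ℕ // d ≠ 0}} {n : ℕ}
    (hn : n < d.1.degree) : oneSubMonomial R d ∈ principalUnits σ R n := by
  classical
  intro l hl
  rw [coeff_oneSubMonomial, if_neg, sub_zero]
  rintro rfl
  omega

lemma oneSubMonomial_mem_principalUnits_zero (d : {d : σ →₀ ℕ // d ≠ 0}) :
    oneSubMonomial R d ∈ principalUnits σ R 0 :=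
  mem_principalUnits_zero.2 (constantCoeff_one_sub_monomial d)

lemma eulerFactor_eq_zpow {m : ℕ} (d : {d : Fin m →₀ ℕ // d ≠ 0}) (n : ℤ) :
    eulerFactor d.1 n =
      ((oneSubMonomial ℝ d ^ n : (MvPowerSeries (Fin m) ℝ)ˣ) : MvPowerSeries (Fin m) ℝ) := by
  have coe_inv : (1 - MvPowerSeries.monomial d.1 (1 : ℝ))⁻¹ =
      ((oneSubMonomial ℝ d)⁻¹ : (MvPowerSeries (Fin m) ℝ)ˣ).val := by
    rw [MvPowerSeries.inv_eq_iff_mul_eq_one (by simp [constantCoeff_one_sub_monomial]),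
      ← coe_oneSubMonomial, Units.inv_mul]
  conv_rhs => rw [← Int.toNat_sub_toNat_neg n, sub_eq_add_neg, zpow_add, zpow_neg, ← inv_zpow,
    zpow_natCast, zpow_natCast, Units.val_mul, Units.val_pow_eq_pow_val, Units.val_pow_eq_pow_val,
    ← coe_inv]
  rfl

end OneSubMonomial

section EulerProduct

lemma continuous_map_intCast {σ : Type*} :
    Continuous (MvPowerSeries.map (Int.castRingHom ℝ) : MvPowerSeries σ ℤ → MvPowerSeries σ ℝ) :=
  continuous_pi fun l => (continuous_of_discreteTopology (f := Int.castRingHom ℝ)).comp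
    (MvPowerSeries.WithPiTopology.continuous_coeff ℤ l)

variable {σ : Type*} [Finite σ]

variable (σ) in
/-- The indices of the Euler factors that involve monomials of degree at most `n`. -/
noncomputable def vectorsUpTo (n : ℕ) : Finset {d : σ →₀ ℕ // d ≠ 0} :=
  ((Finsupp.finite_of_degree_le n).preimage Subtype.val_injective.injOn).toFinset

lemma mem_vectorsUpTo {n : ℕ} {d : {d : σ →₀ ℕ // d ≠ 0}} :
    d ∈ vectorsUpTo σ n ↔ d.1.degree ≤ n := by
  simp [vectorsUpTo]

lemma vectorsUpTo_subset_succ (n : ℕ) : vectorsUpTo σ n ⊆ vectorsUpTo σ (n + 1) := fun _ hd =>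
  mem_vectorsUpTo.2 ((mem_vectorsUpTo.1 hd).trans n.le_succ)

open Classical in
/-- The series left over from `u` when the Euler factors up to degree `n` have been divided off. -/
noncomputable def eulerRemainder (u : (MvPowerSeries σ ℤ)ˣ) : ℕ → (MvPowerSeries σ ℤ)ˣ
  | 0 => u
  | n + 1 => eulerRemainder u n * ∏ d ∈ vectorsUpTo σ (n + 1) \ vectorsUpTo σ n,
      oneSubMonomial ℤ d ^ MvPowerSeries.coeff d.1 (eulerRemainder u n : MvPowerSeries σ ℤ)

/-- The exponents of the Euler product of `u`. -/
noncomputable def eulerExponent (u : (MvPowerSeries σ ℤ)ˣ) (d : {d : σ →₀ ℕ // d ≠ 0}) : ℤ :=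
  -MvPowerSeries.coeff d.1 (eulerRemainder u (d.1.degree - 1) : MvPowerSeries σ ℤ)

lemma degree_eq_of_mem_vectorsUpTo_sdiff [DecidableEq {d : σ →₀ ℕ // d ≠ 0}] {n : ℕ}
    {d : {d : σ →₀ ℕ // d ≠ 0}} (hd : d ∈ vectorsUpTo σ (n + 1) \ vectorsUpTo σ n) :
    d.1.degree = n + 1 := by
  rw [Finset.mem_sdiff, mem_vectorsUpTo, mem_vectorsUpTo] at hd
  omega

/-- Multiplication by `(1 - x ^ d) ^ k` subtracts `k` from the coefficient at `d` and changes no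
other coefficient up to the degree of `d`. -/
lemma eulerRemainder_mem_principalUnits {u : (MvPowerSeries σ ℤ)ˣ}
    (hu : u ∈ principalUnits σ ℤ 0) (n : ℕ) : eulerRemainder u n ∈ principalUnits σ ℤ n := by
  classical
  induction n with
  | zero => exact hu
  | succ n ih =>
    have factor_mem : ∀ d ∈ vectorsUpTo σ (n + 1) \ vectorsUpTo σ n,
        oneSubMonomial ℤ d ∈ principalUnits σ ℤ n := fun d hd =>
      oneSubMonomial_mem_principalUnits (by rw [degree_eq_of_mem_vectorsUpTo_sdiff hd]; simp)
    have prod_mem := Subgroup.prod_mem _ fun d hd => Subgroup.zpow_mem _ (factor_mem d hd)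
      (MvPowerSeries.coeff d.1 (eulerRemainder u n : MvPowerSeries σ ℤ))
    rw [eulerRemainder, mem_principalUnits_succ]
    refine ⟨mul_mem ih prod_mem, fun l hl => ?_⟩
    have l_ne_zero : l ≠ 0 := by
      rintro rfl
      simp at hl
    rw [coeff_mul_of_mem_principalUnits ih prod_mem hl, map_prod_zpow_of_map_mul
      (φ := fun u : (MvPowerSeries σ ℤ)ˣ => MvPowerSeries.coeff l (u : MvPowerSeries σ ℤ))
      (fun u hu v hv => coeff_mul_of_mem_principalUnits hu hv hl) _ factor_mem,
      Finset.sum_eq_single_of_mem ⟨l, l_ne_zero⟩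
        (by simp [mem_vectorsUpTo, hl]) fun d _ hd => ?_]
    · simp [coeff_oneSubMonomial, MvPowerSeries.coeff_one, l_ne_zero]
    · have l_ne : l ≠ d := fun h => hd (Subtype.ext h.symm)
      simp [coeff_oneSubMonomial, MvPowerSeries.coeff_one, l_ne_zero, l_ne]

lemma eulerRemainder_mul_prod (u : (MvPowerSeries σ ℤ)ˣ) (n : ℕ) :
    eulerRemainder u n * ∏ d ∈ vectorsUpTo σ n, oneSubMonomial ℤ d ^ eulerExponent u d = u := by
  classical
  induction n with
  | zero =>
    have no_vectors : vectorsUpTo σ 0 = ∅ := by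
      ext d
      simp [mem_vectorsUpTo, Finsupp.degree_eq_zero_iff, d.2]
    rw [no_vectors, Finset.prod_empty, mul_one, eulerRemainder]
  | succ n ih =>
    have cancel : (∏ d ∈ vectorsUpTo σ (n + 1) \ vectorsUpTo σ n,
        oneSubMonomial ℤ d ^ MvPowerSeries.coeff d.1 (eulerRemainder u n : MvPowerSeries σ ℤ)) *
        ∏ d ∈ vectorsUpTo σ (n + 1) \ vectorsUpTo σ n, oneSubMonomial ℤ d ^ eulerExponent u d =
          1 := by
      rw [← Finset.prod_mul_distrib]
      refine Finset.prod_eq_one fun d hd => ?_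
      rw [eulerExponent, degree_eq_of_mem_vectorsUpTo_sdiff hd, Nat.add_sub_cancel, zpow_neg,
        mul_inv_cancel]
    rw [← Finset.prod_sdiff (vectorsUpTo_subset_succ n), eulerRemainder, mul_assoc,
      ← mul_assoc (∏ d ∈ _, _), cancel, one_mul, ih]

lemma hasProd_oneSubMonomial_zpow {u : (MvPowerSeries σ ℤ)ˣ} (hu : u ∈ principalUnits σ ℤ 0) :
    HasProd (fun d => ((oneSubMonomial ℤ d ^ eulerExponent u d : (MvPowerSeries σ ℤ)ˣ) :
      MvPowerSeries σ ℤ)) u := by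
  classical
  rw [HasProd, SummationFilter.unconditional_filter,
    MvPowerSeries.WithPiTopology.tendsto_iff_coeff_tendsto]
  refine fun l => tendsto_const_nhds.congr' ?_
  filter_upwards [eventually_ge_atTop (vectorsUpTo σ l.degree)] with s hs
  have div_mem : (∏ d ∈ s, oneSubMonomial ℤ d ^ eulerExponent u d) * u⁻¹ ∈
      principalUnits σ ℤ l.degree := by
    rw [← Finset.prod_sdiff hs]
    nth_rw 3 [← eulerRemainder_mul_prod u l.degree]
    rw [mul_inv_rev, ← mul_assoc, mul_inv_cancel_right]
    refine mul_mem (Subgroup.prod_mem _ fun d hd => Subgroup.zpow_mem _ ?_ _)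
      (inv_mem (eulerRemainder_mem_principalUnits hu _))
    exact oneSubMonomial_mem_principalUnits (by simpa [mem_vectorsUpTo] using (mem_sdiff.1 hd).2)
  have coeff_eq := coeff_mul_congr_of_degree_le (mem_principalUnits.1 div_mem) u.val le_rfl
  rw [← Units.val_mul, mul_comm, inv_mul_cancel_right, mul_one] at coeff_eq
  rw [← coeff_eq, Units.coe_prod]

theorem exists_isDTFamily {m : ℕ} {f : MvPowerSeries (Fin m) ℤ}
    (hf : MvPowerSeries.constantCoeff f = 1) :
    ∃ Ω : {d : Fin m →₀ ℕ // d ≠ 0} → ℤ,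
      IsDTFamily (MvPowerSeries.map (Int.castRingHom ℝ) f) Ω := by
  obtain ⟨u, rfl⟩ : IsUnit f := MvPowerSeries.isUnit_iff_constantCoeff.2 (hf ▸ isUnit_one)
  refine ⟨eulerExponent u, ?_⟩
  have map_factor (d : {d : Fin m →₀ ℕ // d ≠ 0}) : eulerFactor d.1 (eulerExponent u d) =
      MvPowerSeries.map (Int.castRingHom ℝ)
        ((oneSubMonomial ℤ d ^ eulerExponent u d : (MvPowerSeries (Fin m) ℤ)ˣ) :
          MvPowerSeries (Fin m) ℤ) := by
    rw [eulerFactor_eq_zpow, ← map_oneSubMonomial (Int.castRingHom ℝ), ← map_zpow]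
    rfl
  simp only [IsDTFamily, map_factor]
  exact (hasProd_oneSubMonomial_zpow (mem_principalUnits_zero.2 hf)).map
    (MvPowerSeries.map (Int.castRingHom ℝ)) continuous_map_intCast

end EulerProduct

section DivVec

variable {m : ℕ} {l : Fin m →₀ ℕ} {k : ℕ}

lemma dvd_gcd_iff : k ∣ univ.gcd l ↔ ∀ i, k ∣ l i := by
  simp [Finset.dvd_gcd_iff]

lemma gcd_ne_zero (hl : l ≠ 0) : univ.gcd l ≠ 0 := fun h =>
  hl (Finsupp.ext fun i => Finset.gcd_eq_zero_iff.1 h i (Finset.mem_univ i))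

lemma gcd_smul (l : Fin m →₀ ℕ) (k : ℕ) : univ.gcd (k • l) = k * univ.gcd l := by
  rw [Finsupp.coe_smul, ← normalize_eq k, ← Finset.gcd_mul_left, normalize_eq]
  rfl

lemma smul_divVec (hk : k ∣ univ.gcd l) : k • divVec l k = l := by
  ext i
  simp [divVec, Nat.mul_div_cancel' (dvd_gcd_iff.1 hk i)]

lemma divVec_smul (hk : 0 < k) : divVec (k • l) k = l := by
  ext i
  simp [divVec, Nat.mul_div_cancel_left _ hk]

lemma divVec_smul_of_dvd {n : ℕ} (hk : 0 < k) (hkn : k ∣ n) : divVec (n • l) k = (n / k) • l := by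
  conv_lhs => rw [← Nat.mul_div_cancel' hkn, mul_smul, divVec_smul hk]

lemma divVec_ne_zero (hl : l ≠ 0) (hk : k ∣ univ.gcd l) : divVec l k ≠ 0 := fun h =>
  hl (by rw [← smul_divVec hk, h, smul_zero])

lemma eq_smul_iff_divVec_eq {d : Fin m →₀ ℕ} (hk : k ∈ (univ.gcd l).divisors) :
    l = k • d ↔ divVec l k = d := by
  refine ⟨?_, ?_⟩
  · rintro rfl
    exact divVec_smul (Nat.pos_of_mem_divisors hk)
  · rintro rfl
    exact (smul_divVec (Nat.dvd_of_mem_divisors hk)).symm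

lemma divisors_gcd_subset_range_degree (hl : l ≠ 0) :
    (univ.gcd l).divisors ⊆ range (l.degree + 1) := fun k hk => by
  have hk := Nat.dvd_of_mem_divisors hk
  rw [Finset.mem_range, Nat.lt_succ_iff, ← smul_divVec hk, map_nsmul, smul_eq_mul]
  exact Nat.le_mul_of_pos_right k <| Nat.pos_of_ne_zero <|
    (Finsupp.degree_eq_zero_iff _).not.2 (divVec_ne_zero hl hk)

lemma mul_apply_divVec_smul_div {K : Type*} [Field K] [CharZero K] (f : (Fin m →₀ ℕ) → K)
    (l : Fin m →₀ ℕ) {n : ℕ} (hk : k ∈ n.divisors) :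
    (n : K) * (f (divVec (n • l) k) / k) = (n / k : ℕ) * f ((n / k) • l) := by
  have k_ne_zero : (k : K) ≠ 0 := Nat.cast_ne_zero.2 (Nat.pos_of_mem_divisors hk).ne'
  rw [divVec_smul_of_dvd (Nat.pos_of_mem_divisors hk) (Nat.dvd_of_mem_divisors hk),
    Nat.cast_div (Nat.dvd_of_mem_divisors hk) k_ne_zero]
  ring

lemma moebius_inversion_divVec {K : Type*} [Field K] [CharZero K] {f g : (Fin m →₀ ℕ) → K}
    (hfg : ∀ l ≠ 0, ∑ k ∈ (univ.gcd l).divisors, f (divVec l k) / k = g l) (hl : l ≠ 0) :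
    f l = ∑ n ∈ (univ.gcd l).divisors, (ArithmeticFunction.moebius n : K) / n * g (divVec l n) := by
  obtain ⟨n, r, hn, hr, rfl⟩ : ∃ (n : ℕ) (r : Fin m →₀ ℕ), 0 < n ∧ univ.gcd r = 1 ∧ n • r = l := by
    have gcd_pos := Nat.pos_of_ne_zero (gcd_ne_zero hl)
    refine ⟨univ.gcd l, divVec l (univ.gcd l), gcd_pos, ?_, smul_divVec dvd_rfl⟩
    refine Nat.eq_of_mul_eq_mul_left gcd_pos ?_
    rw [← gcd_smul, smul_divVec dvd_rfl, mul_one]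
  have gcd_smul_r (k : ℕ) : univ.gcd (k • r) = k := by rw [gcd_smul, hr, mul_one]
  have sum_multiples : ∀ n : ℕ, 0 < n →
      ∑ k ∈ n.divisors, (k : K) * f (k • r) = (n : K) * g (n • r) := fun n hn => by
    rw [← hfg (n • r) (smul_ne_zero hn.ne' (right_ne_zero_of_smul hl)), gcd_smul_r,
      Finset.mul_sum, ← Nat.sum_div_divisors]
    exact Finset.sum_congr rfl fun k hk => (mul_apply_divVec_smul_div f r hk).symm
  have inverted := ArithmeticFunction.sum_eq_iff_sum_mul_moebius_eq.1 sum_multiples n hn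
  rw [Nat.sum_divisorsAntidiagonal
    (f := fun a b => (ArithmeticFunction.moebius a : K) * (b * g (b • r)))] at inverted
  refine mul_left_cancel₀ (Nat.cast_ne_zero.2 hn.ne' : (n : K) ≠ 0) ?_
  rw [← inverted, gcd_smul_r, Finset.mul_sum]
  refine Finset.sum_congr rfl fun k hk => ?_
  rw [← mul_apply_divVec_smul_div g r hk]
  ring

end DivVec

section DTInvariants

variable {m : ℕ} {y : MvPowerSeries (Fin m) ℝ}

lemma hasSum_formalLog_of_isDTFamily (hy : MvPowerSeries.constantCoeff y = 1)
    {Ω : {d : Fin m →₀ ℕ // d ≠ 0} → ℤ} (hΩ : IsDTFamily y Ω) :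
    HasSum (fun d => Ω d • formalLog (oneSubMonomial ℝ d : MvPowerSeries (Fin m) ℝ))
      (formalLog y) := by
  have partial_log (s : Finset {d : Fin m →₀ ℕ // d ≠ 0}) :
      formalLog (∏ d ∈ s, eulerFactor d.1 (Ω d)) =
        ∑ d ∈ s, Ω d • formalLog (oneSubMonomial ℝ d : MvPowerSeries (Fin m) ℝ) := by
    simp only [eulerFactor_eq_zpow]
    rw [← Units.coe_prod, formalLog_prod_zpow s fun d _ => oneSubMonomial_mem_principalUnits_zero d]
  have constantCoeff_partial (s : Finset {d : Fin m →₀ ℕ // d ≠ 0}) :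
      MvPowerSeries.constantCoeff (∏ d ∈ s, eulerFactor d.1 (Ω d)) = 1 := by
    simp only [eulerFactor_eq_zpow]
    rw [← Units.coe_prod]
    exact mem_principalUnits_zero.1 <| Subgroup.prod_mem _ fun d _ =>
      Subgroup.zpow_mem _ (oneSubMonomial_mem_principalUnits_zero d) _
  simp only [HasSum, ← partial_log]
  exact (continuousOn_formalLog y hy).tendsto.comp <| tendsto_nhdsWithin_iff.2
    ⟨hΩ, Eventually.of_forall constantCoeff_partial⟩

lemma coeff_formalLog_oneSubMonomial {K : Type*} [Field K] [CharZero K]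
    (d : {d : Fin m →₀ ℕ // d ≠ 0}) {l : Fin m →₀ ℕ} (hl : l ≠ 0) :
    MvPowerSeries.coeff l (formalLog (oneSubMonomial K d : MvPowerSeries (Fin m) K)) =
      -∑ k ∈ (univ.gcd l).divisors, if divVec l k = d then 1 / (k : K) else 0 := by
  classical
  have pow_eq (k : ℕ) : (1 - MvPowerSeries.monomial d.1 (1 : K) - 1) ^ k =
      MvPowerSeries.monomial (k • d.1) ((-1 : K) ^ k) := by
    rw [sub_sub_cancel_left, ← map_neg, MvPowerSeries.monomial_pow]
  simp only [coe_oneSubMonomial]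
  rw [coeff_formalLog (constantCoeff_one_sub_monomial d), ← Finset.sum_neg_distrib,
    ← Finset.sum_subset (divisors_gcd_subset_range_degree hl)]
  · refine Finset.sum_congr rfl fun k hk => ?_
    have k_ne_zero := (Nat.pos_of_mem_divisors hk).ne'
    rw [pow_eq, MvPowerSeries.coeff_monomial, PowerSeries.coeff_log, if_neg k_ne_zero]
    simp only [eq_smul_iff_divVec_eq hk]
    split_ifs
    · simp [pow_succ, div_mul_eq_mul_div, ← mul_pow, neg_div]
    · simp
  · intro k _ hk
    rw [pow_eq, MvPowerSeries.coeff_monomial, if_neg, mul_zero]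
    rintro rfl
    exact hk (Nat.mem_divisors.2 ⟨dvd_gcd_iff.2 fun i => ⟨d.1 i, by simp⟩, gcd_ne_zero hl⟩)

lemma sum_divisors_gcd_eq_neg_coeff_formalLog (hy : MvPowerSeries.constantCoeff y = 1)
    {Ω : (Fin m →₀ ℕ) → ℤ} (hΩ : IsDTFamily y fun d => Ω d.1) {l : Fin m →₀ ℕ} (hl : l ≠ 0) :
    ∑ k ∈ (univ.gcd l).divisors, (Ω (divVec l k) : ℝ) / k =
      -MvPowerSeries.coeff l (formalLog y) := by
  have coeff_sum := (hasSum_formalLog_of_isDTFamily hy hΩ).map (MvPowerSeries.coeff l)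
    (MvPowerSeries.WithPiTopology.continuous_coeff ℝ l)
  refine HasSum.unique ?_ coeff_sum.neg
  have single (k : ℕ) (hk : k ∈ (univ.gcd l).divisors) :
      HasSum (fun d : {d : Fin m →₀ ℕ // d ≠ 0} =>
        if divVec l k = d then (Ω d : ℝ) / k else 0) (Ω (divVec l k) / k) := by
    have divVec_ne := divVec_ne_zero hl (Nat.dvd_of_mem_divisors hk)
    convert hasSum_single (⟨divVec l k, divVec_ne⟩ : {d : Fin m →₀ ℕ // d ≠ 0}) fun d hd => ?_
    · simp
    · exact if_neg fun h => hd (Subtype.ext h.symm)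
  refine (hasSum_sum single).congr_fun fun d => ?_
  rw [Function.comp_apply, map_zsmul, coeff_formalLog_oneSubMonomial d hl, zsmul_eq_mul, mul_neg,
    neg_neg, Finset.mul_sum]
  simp only [mul_ite, mul_one_div, mul_zero]

theorem eq_sum_moebius_of_isDTFamily (hy : MvPowerSeries.constantCoeff y = 1)
    {Ω : {d : Fin m →₀ ℕ // d ≠ 0} → ℤ} (hΩ : IsDTFamily y Ω) (d : {d : Fin m →₀ ℕ // d ≠ 0}) :
    (Ω d : ℝ) = -∑ n ∈ (univ.gcd d.1).divisors, (ArithmeticFunction.moebius n : ℝ) / n *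
      MvPowerSeries.coeff (divVec d.1 n) (logSeries y) := by
  obtain ⟨Ω, rfl⟩ : ∃ Ω' : (Fin m →₀ ℕ) → ℤ, (fun d => Ω' d.1) = Ω :=
    ⟨Function.extend Subtype.val Ω 0, funext fun d => Subtype.val_injective.extend_apply Ω 0 d⟩
  rw [moebius_inversion_divVec (f := fun l => (Ω l : ℝ))
    (fun l hl => sum_divisors_gcd_eq_neg_coeff_formalLog hy hΩ hl) d.2, ← Finset.sum_neg_distrib]
  simp only [mul_neg]
  rfl

end DTInvariants

section LagrangePolynomial

variable {R S : Type*} [CommRing R] [Module ℚ≥0 R] [CommRing S] [Module ℚ≥0 S]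
  {ι : Type*} [Fintype ι] [DecidableEq ι]

/-- The Lagrange determinant at the point `X + ∑ i, M i j * l i`. For the matrix of a symmetric
quiver its value at `X = n` is, up to sign, the coefficient of `x ^ l` in the `n`-th power of the
classical limit. -/
noncomputable def lagrangePolynomial (M : Matrix ι ι R) (l : ι → ℕ) : Polynomial R :=
  (lagrangeMatrix (M.map Polynomial.C)
    (fun j => Polynomial.X + Polynomial.C (∑ i, M i j * (l i : R))) l).det

lemma map_lagrangePolynomial (f : R →+* S) (M : Matrix ι ι R) (l : ι → ℕ) :
    (lagrangePolynomial M l).map f = lagrangePolynomial (M.map f) l := by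
  rw [lagrangePolynomial, lagrangePolynomial, ← Polynomial.coe_mapRingHom, map_det_lagrangeMatrix]
  congr 2
  · ext1 i j
    simp
  · ext1 j
    simp [Polynomial.map_sum]

lemma continuous_coeff_lagrangePolynomial [TopologicalSpace R] [IsTopologicalRing R] (l : ι → ℕ)
    (k : ℕ) : Continuous fun M : Matrix ι ι R => (lagrangePolynomial M l).coeff k := by
  have coeff_eq_eval (M : Matrix ι ι R) : (lagrangePolynomial M l).coeff k =
      MvPolynomial.eval (fun e : ι × ι => M e.1 e.2)
        ((lagrangePolynomial (Matrix.mvPolynomialX ι ι R) l).coeff k) := by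
    rw [← Polynomial.coeff_map, map_lagrangePolynomial, ← RingHom.mapMatrix_apply,
      Matrix.mvPolynomialX_mapMatrix_eval]
  simp only [coeff_eq_eval]
  exact (MvPolynomial.continuous_eval _).comp <|
    continuous_pi fun e => continuous_id.matrix_elem e.1 e.2

open Classical in
lemma prod_mul_lagrangePolynomial {m : ℕ} (M : Matrix (Fin m) (Fin m) R) (l : Fin m → ℕ) :
    (∏ j, (Polynomial.X + Polynomial.C (∑ i, M i j * (l i : R)))) * lagrangePolynomial M l =
      (∏ j, Ring.choose (Polynomial.X + Polynomial.C (∑ i, M i j * (l i : R))) (l j)) *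
        ∑ S with IsAdmissible S,
          Polynomial.X ^ (m - S.card) * Polynomial.C (∏ e ∈ S, M e.1 e.2 * (l e.1 : R)) := by
  have forest_sum := det_laplacian Polynomial.X
    (Matrix.of fun i j => Polynomial.C (M i j * (l i : R)))
  simp only [Matrix.of_apply, ← map_sum, ← map_prod] at forest_sum
  rw [lagrangePolynomial, prod_mul_det_lagrangeMatrix, ← forest_sum]
  congr 3
  ext1 i j
  simp [mul_comm]

end LagrangePolynomial

section LogCoefficient

variable {m : ℕ}

lemma powPolynomial_classicalLimit (C : Matrix (Fin m) (Fin m) ℕ) (hC : C.IsSymm)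
    (l : Fin m →₀ ℕ) :
    powPolynomial (classicalLimit C) l =
      Polynomial.C ((-1) ^ signExponent C l) *
        lagrangePolynomial (C.map (Nat.cast : ℕ → ℝ)) l := by
  refine polynomial_eq_of_eval_natCast fun n => ?_
  rw [eval_powPolynomial (constantCoeff_classicalLimit C), coeff_classicalLimit_pow C hC,
    Polynomial.eval_mul, Polynomial.eval_C, lagrangePolynomial, ← Polynomial.coe_evalRingHom,
    map_det_lagrangeMatrix]
  congr 3
  · ext1 i j
    simp
  · ext1 j
    simp [linForm, Polynomial.eval_finsetSum]

lemma coeff_logSeries_classicalLimit (C : Matrix (Fin m) (Fin m) ℕ) (hC : C.IsSymm)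
    (l : Fin m →₀ ℕ) :
    MvPowerSeries.coeff l (logSeries (classicalLimit C)) =
      (-1) ^ signExponent C l * (lagrangePolynomial (C.map (Nat.cast : ℕ → ℝ)) l).coeff 1 := by
  rw [← Polynomial.coeff_C_mul, ← powPolynomial_classicalLimit C hC,
    coeff_one_powPolynomial (constantCoeff_classicalLimit C)]
  rfl

lemma mem_admissibleSets {k : ℕ} {S : Finset (Fin m × Fin m)} :
    S ∈ admissibleSets m k ↔ IsAdmissible S ∧ S.card = k := by
  classical
  simp [admissibleSets]

lemma Amax_eq_sum (M : Matrix (Fin m) (Fin m) ℝ) (l : Fin m →₀ ℕ) :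
    Amax M l = ∑ S ∈ admissibleSets m (m - 1), ∏ e ∈ S, (M e.1 e.2 * (l e.1 : ℝ)) := by
  simp [Amax, polyAmax, map_sum, map_prod]

open Classical in
lemma coeff_one_admissible_sum (hm : 0 < m) (M : Matrix (Fin m) (Fin m) ℝ) (l : Fin m →₀ ℕ) :
    (∑ S with IsAdmissible S, Polynomial.X ^ (m - S.card) *
      Polynomial.C (∏ e ∈ S, M e.1 e.2 * (l e.1 : ℝ))).coeff 1 = Amax M l := by
  have maximal_sets : admissibleSets m (m - 1) =
      {S ∈ ({S | IsAdmissible S} : Finset (Finset (Fin m × Fin m))) | S.card = m - 1} := by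
    ext S
    simp [mem_admissibleSets]
  rw [Amax_eq_sum, maximal_sets, Polynomial.finsetSum_coeff]
  refine (Finset.sum_congr rfl fun S _ => ?_).trans (Finset.sum_filter _ _).symm
  have card_iff : 1 = m - S.card ↔ S.card = m - 1 := by omega
  simp only [Polynomial.coeff_mul_C, Polynomial.coeff_X_pow, card_iff, ite_mul, one_mul, zero_mul]

open Classical in
lemma coeff_zero_admissible_sum (hm : 0 < m) (M : Matrix (Fin m) (Fin m) ℝ) (l : Fin m →₀ ℕ) :
    (∑ S with IsAdmissible S, Polynomial.X ^ (m - S.card) *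
      Polynomial.C (∏ e ∈ S, M e.1 e.2 * (l e.1 : ℝ))).coeff 0 = 0 := by
  rw [Polynomial.finsetSum_coeff]
  refine Finset.sum_eq_zero fun S hS => ?_
  have exponent_ne_zero : 0 ≠ m - S.card := by
    have := (Finset.mem_filter.1 hS).2.card_le
    omega
  rw [Polynomial.coeff_mul_C, Polynomial.coeff_X_pow, if_neg exponent_ne_zero, zero_mul]

lemma coeff_one_lagrangePolynomial (hm : 0 < m) {M : Matrix (Fin m) (Fin m) ℝ} {l : Fin m →₀ ℕ}
    (hM : ∀ j, linForm M l j ≠ 0) : (lagrangePolynomial M l).coeff 1 = unsignedTerm M l := by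
  have prod_ne_zero : ∏ j, linForm M l j ≠ 0 := Finset.prod_ne_zero_iff.2 fun j _ => hM j
  have coeff_zero_prod :
      (∏ j, (Polynomial.X + Polynomial.C (∑ i, M i j * (l i : ℝ)))).coeff 0 =
        ∏ j, linForm M l j := by
    simp [Polynomial.coeff_zero_eq_eval_zero, Polynomial.eval_prod, Polynomial.eval_finsetSum,
      linForm]
  have coeff_zero_choose :
      (∏ j, Ring.choose (Polynomial.X + Polynomial.C (∑ i, M i j * (l i : ℝ))) (l j)).coeff 0 =
        ∏ j, Ring.choose (linForm M l j) (l j) := by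
    simp only [Polynomial.coeff_zero_eq_eval_zero, ← Polynomial.coe_evalRingHom, map_prod,
      Ring.map_choose]
    simp [linForm, Polynomial.eval_finsetSum]
  have key := prod_mul_lagrangePolynomial M l
  have coeff_zero := congrArg (Polynomial.coeff · 0) key
  have coeff_one := congrArg (Polynomial.coeff · 1) key
  simp only [Polynomial.mul_coeff_zero, coeff_zero_admissible_sum hm, mul_zero, coeff_zero_prod,
    mul_eq_zero, prod_ne_zero, false_or] at coeff_zero
  simp only [Polynomial.mul_coeff_one, coeff_zero_admissible_sum hm, coeff_one_admissible_sum hm,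
    coeff_zero_prod, coeff_zero_choose, coeff_zero, mul_zero, add_zero] at coeff_one
  rw [unsignedTerm, Finset.prod_mul_distrib, Finset.prod_div_distrib, Finset.prod_const_one]
  field_simp
  linear_combination coeff_one

lemma pos_of_ne_zero {l : Fin m →₀ ℕ} (hl : l ≠ 0) : 0 < m := by
  obtain ⟨i, -⟩ := Finsupp.ne_iff.1 hl
  exact i.pos

lemma regularNhds_neBot (C : Matrix (Fin m) (Fin m) ℕ) {l : Fin m →₀ ℕ} (hl : l ≠ 0) :
    (regularNhds C l).NeBot := by
  rw [regularNhds, ← mem_closure_iff_nhdsWithin_neBot]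
  have shift_continuous : Continuous fun ε : ℝ => Matrix.of fun i j => (C i j : ℝ) + ε :=
    continuous_matrix fun i j => continuous_const.add continuous_id
  have shift_tendsto := (shift_continuous.tendsto 0).mono_left
    (nhdsWithin_le_nhds (s := Set.Ioi 0))
  simp only [add_zero] at shift_tendsto
  refine mem_closure_of_tendsto shift_tendsto ?_
  filter_upwards [self_mem_nhdsWithin] with ε (hε : 0 < ε) j
  obtain ⟨i, hi⟩ := Finsupp.ne_iff.1 hl
  have li_pos : 0 < l i := Nat.pos_of_ne_zero hi
  refine (Finset.sum_pos' (fun k _ => ?_) ⟨i, Finset.mem_univ i, ?_⟩).ne' <;>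
    simp only [Matrix.of_apply] <;> positivity

lemma tendsto_unsignedTerm (C : Matrix (Fin m) (Fin m) ℕ) {l : Fin m →₀ ℕ} (hl : l ≠ 0) :
    Tendsto (fun M => unsignedTerm M l) (regularNhds C l)
      (𝓝 ((lagrangePolynomial (C.map (Nat.cast : ℕ → ℝ)) l).coeff 1)) := by
  refine (((continuous_coeff_lagrangePolynomial l 1).tendsto _).mono_left
    nhdsWithin_le_nhds).congr' ?_
  filter_upwards [self_mem_nhdsWithin] with M hM
  exact coeff_one_lagrangePolynomial (pos_of_ne_zero hl) hM

lemma logCoeff_eq (C : Matrix (Fin m) (Fin m) ℕ) {l : Fin m →₀ ℕ} (hl : l ≠ 0) :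
    logCoeff C l =
      (-1) ^ signExponent C l * (lagrangePolynomial (C.map (Nat.cast : ℕ → ℝ)) l).coeff 1 := by
  have := regularNhds_neBot C hl
  rw [logCoeff, (tendsto_unsignedTerm C hl).limUnder_eq]

theorem tendsto_logCoeff (C : Matrix (Fin m) (Fin m) ℕ) {l : Fin m →₀ ℕ} (hl : l ≠ 0) :
    Tendsto (fun M => (-1) ^ signExponent C l * unsignedTerm M l) (regularNhds C l)
      (𝓝 (logCoeff C l)) := by
  rw [logCoeff_eq C hl]
  exact (tendsto_unsignedTerm C hl).const_mul _

theorem logCoeff_eq_of_ne_zero (C : Matrix (Fin m) (Fin m) ℕ) {l : Fin m →₀ ℕ} (hl : l ≠ 0)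
    (h : ∀ j, ∑ i, C i j * l i ≠ 0) :
    logCoeff C l = (-1) ^ (∑ i, (C i i + 1) * l i) * Amax (C.map (Nat.cast : ℕ → ℝ)) l *
      ∏ j, (1 / ((∑ i, C i j * l i : ℕ) : ℝ) * ((∑ i, C i j * l i).choose (l j) : ℝ)) := by
  have linForm_eq (j : Fin m) :
      linForm (C.map (Nat.cast : ℕ → ℝ)) l j = (∑ i, C i j * l i : ℕ) := by
    simp [linForm]
  have linForm_ne_zero (j : Fin m) : linForm (C.map (Nat.cast : ℕ → ℝ)) l j ≠ 0 :=
    linForm_eq j ▸ Nat.cast_ne_zero.2 (h j)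
  rw [logCoeff_eq C hl, coeff_one_lagrangePolynomial (pos_of_ne_zero hl) linForm_ne_zero,
    unsignedTerm, signExponent, mul_assoc]
  simp only [linForm_eq, Ring.choose_natCast]

theorem logSeries_classicalLimit (C : Matrix (Fin m) (Fin m) ℕ) (hC : C.IsSymm) :
    logSeries (classicalLimit C) = fun l => if l = 0 then 0 else logCoeff C l := by
  ext l
  change _ = if l = 0 then 0 else logCoeff C l
  split_ifs with hl
  · rw [hl]
    exact (coeff_formalLog (constantCoeff_classicalLimit C) 0).trans (by simp)
  · rw [coeff_logSeries_classicalLimit C hC, logCoeff_eq C hl]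

theorem eq_sum_moebius_logCoeff (C : Matrix (Fin m) (Fin m) ℕ) (hC : C.IsSymm)
    {Ω : {d : Fin m →₀ ℕ // d ≠ 0} → ℤ} (hΩ : IsDTFamily (classicalLimit C) Ω)
    (d : {d : Fin m →₀ ℕ // d ≠ 0}) :
    (Ω d : ℝ) = -∑ n ∈ (univ.gcd d.1).divisors, (ArithmeticFunction.moebius n : ℝ) / n *
      logCoeff C (divVec d.1 n) := by
  rw [eq_sum_moebius_of_isDTFamily (constantCoeff_classicalLimit C) hΩ d]
  congr 1
  refine Finset.sum_congr rfl fun n hn => ?_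
  have divVec_ne := divVec_ne_zero d.2 (Nat.dvd_of_mem_divisors hn)
  rw [coeff_logSeries_classicalLimit C hC, logCoeff_eq C divVec_ne]

end LogCoefficient

section Degree

variable {m : ℕ} (M : Matrix (Fin m) (Fin m) ℝ)

/-- The sum of the terms of the polynomial `A` indexed by admissible sets of size `k`. -/
noncomputable def admissiblePart (k : ℕ) : MvPolynomial (Fin m) ℝ :=
  ∑ S ∈ admissibleSets m k, ∏ p ∈ S, MvPolynomial.C (M p.1 p.2) * MvPolynomial.X p.1

lemma isHomogeneous_admissiblePart (k : ℕ) : (admissiblePart M k).IsHomogeneous k := by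
  refine MvPolynomial.IsHomogeneous.sum _ _ _ fun S hS => ?_
  obtain ⟨-, rfl⟩ := mem_admissibleSets.1 hS
  rw [Finset.card_eq_sum_ones]
  exact MvPolynomial.IsHomogeneous.prod S _ _ fun p _ => MvPolynomial.isHomogeneous_C_mul_X _ _

lemma admissibleSets_zero : admissibleSets m 0 = {∅} := by
  have isAdmissible_empty : IsAdmissible (∅ : Finset (Fin m × Fin m)) :=
    ⟨by simp, fun n f _ hf => absurd (hf 0) (by simp)⟩
  ext S
  rw [mem_admissibleSets, Finset.card_eq_zero, Finset.mem_singleton, and_iff_right_iff_imp]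
  rintro rfl
  exact isAdmissible_empty

lemma polyA_eq_sum : polyA M = ∑ k ∈ range (m - 1 + 1), admissiblePart M k := by
  rw [Finset.range_eq_Ico, Finset.sum_eq_sum_Ico_succ_bot (Nat.succ_pos _), admissiblePart,
    admissibleSets_zero, Finset.sum_singleton, Finset.prod_empty]
  rfl

theorem totalDegree_polyA_le : (polyA M).totalDegree ≤ m - 1 := by
  rw [polyA_eq_sum]
  exact MvPolynomial.totalDegree_finsetSum_le fun k hk =>
    (isHomogeneous_admissiblePart M k).totalDegree_le.trans (Nat.lt_succ_iff.1 (mem_range.1 hk))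

theorem homogeneousComponent_polyA :
    MvPolynomial.homogeneousComponent (m - 1) (polyA M) = polyAmax M := by
  rw [polyA_eq_sum, map_sum, Finset.sum_eq_single_of_mem (m - 1) (self_mem_range_succ _)]
  · rw [MvPolynomial.homogeneousComponent_of_mem (isHomogeneous_admissiblePart M _), if_pos rfl]
    rfl
  · intro k _ hk
    rw [MvPolynomial.homogeneousComponent_of_mem (isHomogeneous_admissiblePart M k), if_neg hk.symm]

end Degree

end SymmetricQuiver

theorem mainTheorem2 (m : ℕ) (C : Matrix (Fin m) (Fin m) ℕ) (hC : C.IsSymm) :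
    -- the classical generating series `y` exists
    (∃ y : MvPowerSeries (Fin m) ℝ,
      SymmetricQuiver.IsClassicalLimit C y ∧
      MvPowerSeries.constantCoeff y = 1 ∧
      -- the formula for its logarithm
      SymmetricQuiver.logSeries y = (fun l => if l = 0 then 0 else SymmetricQuiver.logCoeff C l) ∧
      -- the numerical Donaldson-Thomas invariants exist and are given by Möbius inversion
      (∃ Ω : {d : Fin m →₀ ℕ // d ≠ 0} → ℤ, SymmetricQuiver.IsDTFamily y Ω) ∧
      (∀ Ω : {d : Fin m →₀ ℕ // d ≠ 0} → ℤ, SymmetricQuiver.IsDTFamily y Ω →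
        ∀ d : {d : Fin m →₀ ℕ // d ≠ 0},
          (Ω d : ℝ) = -∑ n ∈ (Finset.univ.gcd d.1).divisors,
            (ArithmeticFunction.moebius n : ℝ) / (n : ℝ) *
              SymmetricQuiver.logCoeff C (SymmetricQuiver.divVec d.1 n))) ∧
    -- the value by continuity in the formula exists for every nonzero `l`
    (∀ l : Fin m →₀ ℕ, l ≠ 0 →
      (SymmetricQuiver.regularNhds C l).NeBot ∧
      Filter.Tendsto
        (fun M => (-1) ^ SymmetricQuiver.signExponent C l * SymmetricQuiver.unsignedTerm M l)
        (SymmetricQuiver.regularNhds C l) (nhds (SymmetricQuiver.logCoeff C l))) ∧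
    -- it is the value of the formula itself wherever no denominator vanishes
    (∀ l : Fin m →₀ ℕ, l ≠ 0 → (∀ j, ∑ i, C i j * l i ≠ 0) →
      SymmetricQuiver.logCoeff C l =
        (-1) ^ (∑ i, (C i i + 1) * l i) *
          SymmetricQuiver.Amax (C.map (fun n : ℕ => (n : ℝ))) l *
          ∏ j, (1 / ((∑ i, C i j * l i : ℕ) : ℝ) *
            ((∑ i, C i j * l i).choose (l j) : ℝ))) ∧
    -- `m - 1` is the maximal size of an admissible set
    (∀ S : Finset (Fin m × Fin m), SymmetricQuiver.IsAdmissible S → S.card ≤ m - 1) ∧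
    (∃ S : Finset (Fin m × Fin m), SymmetricQuiver.IsAdmissible S ∧ S.card = m - 1) ∧
    -- `A` has degree at most `m - 1`, and `A_max` is its homogeneous part of degree `m - 1`
    (SymmetricQuiver.polyA (C.map (fun n : ℕ => (n : ℝ)))).totalDegree ≤ m - 1 ∧
    MvPolynomial.homogeneousComponent (m - 1)
        (SymmetricQuiver.polyA (C.map (fun n : ℕ => (n : ℝ)))) =
      SymmetricQuiver.polyAmax (C.map (fun n : ℕ => (n : ℝ))) := by
  refine ⟨⟨SymmetricQuiver.classicalLimit C, SymmetricQuiver.isClassicalLimit_classicalLimit C hC,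
    SymmetricQuiver.constantCoeff_classicalLimit C, SymmetricQuiver.logSeries_classicalLimit C hC,
    SymmetricQuiver.exists_isDTFamily (SymmetricQuiver.constantCoeff_lagrangeSeries C _),
    fun Ω hΩ d => SymmetricQuiver.eq_sum_moebius_logCoeff C hC hΩ d⟩,
    fun l hl => ⟨SymmetricQuiver.regularNhds_neBot C hl, SymmetricQuiver.tendsto_logCoeff C hl⟩,
    fun l hl h => SymmetricQuiver.logCoeff_eq_of_ne_zero C hl h, fun S hS => hS.card_le,
    SymmetricQuiver.exists_isAdmissible_card_eq m, SymmetricQuiver.totalDegree_polyA_le _,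
    SymmetricQuiver.homogeneousComponent_polyA _⟩
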